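/- **Theorem 5.1 (Sampling Theorem).** Let $d,N\in\mathbb N$, let $(\Delta,\mathcal A,\mathbf P)$ be a probability space, $c\in\mathbb R^d$, and let $\mathbb X\subset\mathbb R^d$ be compact and convex. For each stage $i=1,\dots,N$ let $f_i:\mathbb R^d\times\Delta\to\mathbb R$ be such that $f_i(x,\cdot)$ is measurable for every $x\in\mathbb R^d$ and $f_i(\cdot,\delta)$ is convex on $\mathbb R^d$ for $\mathbf P$-almost every $\delta$, and let $\epsilon_i\in(0,1)$. For $K=(K_1,\dots,K_N)\in\mathbb N^N$ (with $0\in\mathbb N$) and multi-samples $\omega^{(i)}=(\delta^{(i,1)},\dots,\delta^{(i,K_i)})\in\Delta^{K_i}$, $\omega=(\omega^{(1)},\dots,\omega^{(N)})$, consider the multi-stage randomized program $$\min_{x\in\mathbb X}\ c^{\mathsf T}x\quad\text{s.t.}\quad f_i(x,\delta^{(i,\kappa)})\le 0\quad\text{for all }\kappa=1,\dots,K_i,\ i=1,\dots,N .$$ All samples are independent with law $\mathbf P$; their joint law on $\prod_i\Delta^{K_i}$ is denoted by $\mathbf P^{K}$. Assume that for every $K\in\mathbb N^N$ this program is feasible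 for $\mathbf P^K$-almost every $\omega$. Among several cost-optimal points one is selected by a tie-break rule: convex functions $t_1,\dots,t_p:\mathbb R^d\to\mathbb R$ are minimized successively over the cost-optimal points, where it is assumed that on every compact convex subset of $\mathbb X$ at most one point is optimal in this sense, i.e. minimizes $(c^{\mathsf T}x,t_1(x),\dots,t_p(x))$ lexicographically (for example, $p=d$ and $t_j(x)=x_j$, the lexicographic order on $\mathbb R^d$). Let $x^\circ(\omega)$ be the resulting unique optimal point of the program, defined for almost every $\omega$ (and put $x^\circ(\omega)=0$ where there is none), and let $$V_i(\omega):=\mathbf P\{\delta\in\Delta : f_i(x^\circ(\omega),\delta)>0\}$$ be the violation probability of stage $i$. Let $S_i$ be the largest linear subspace $L\subseteq\mathbb R^d$ such that, for $\mathbf P$-almost every $\delta$, $f_i(x+\xi,\delta)=f_i(x,\delta)$ for all $x\in\mathbb X$ and $\xi\in L$, and let $\zeta_i:=d-\dim S_i$ be the support rank of stage $i$. Then for all sample sizes $K_1,\dots,K_N\in\mathbb N$ and every stage $i=1,\dots,N$, $$\mathbf P^{K}\bigl[V_i(\omega^{(1)},\dots,\omega^{(N)})>\epsilon_i\bigr]\le\Phi(\zeta_i-1;K_i,\epsilon_i),\qquad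 \Phi(x;n,\epsilon):=\sum_{j=0}^{x}\binom nj\epsilon^j(1-\epsilon)^{n-j},$$ where $\Phi(-1;n,\epsilon)=0$. No non-degeneracy or regularity of the program is assumed. -/

import Mathlib

open MeasureTheory

/-- The data of a multi-stage program in `ℝ^d` with `N` stages and uncertainty set `Δ`.
The functions `tieBreak 0, …, tieBreak (p-1)` are minimized successively (lexicographically)
over the cost-optimal points in order to select a single one; the lexicographic order on `ℝ^d`
is the case `p = d`, `tieBreak j x = x j`. -/
structure MultiStageProgram (d N : ℕ) (Δ : Type*) where
  /-- the cost vector -/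
  c : EuclideanSpace ℝ (Fin d)
  /-- the deterministic constraint set -/
  X : Set (EuclideanSpace ℝ (Fin d))
  /-- the constraint functions of the stages -/
  f : Fin N → EuclideanSpace ℝ (Fin d) → Δ → ℝ
  /-- the number of tie-break functions -/
  p : ℕ
  /-- the tie-break functions -/
  tieBreak : Fin p → EuclideanSpace ℝ (Fin d) → ℝ

namespace MultiStageProgram

variable {d N : ℕ} {Δ : Type*}

/-- The list `(cᵀx, t₁(x), …, t_p(x))`, compared lexicographically. -/
noncomputable def preference (M : MultiStageProgram d N Δ) (x : EuclideanSpace ℝ (Fin d)) :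
    Lex (Fin (M.p + 1) → ℝ) :=
  toLex (Fin.cons (inner ℝ M.c x) (fun j => M.tieBreak j x))

/-- `x` minimizes the cost over `C` and is preferred by the tie-break rule among all points of `C`
of the same cost. -/
def IsOptimal (M : MultiStageProgram d N Δ) (C : Set (EuclideanSpace ℝ (Fin d)))
    (x : EuclideanSpace ℝ (Fin d)) : Prop :=
  x ∈ C ∧ ∀ y ∈ C, M.preference x ≤ M.preference y

/-- The tie-break rule is appropriate: its functions are convex, and it leaves at most one optimal
point on every compact convex subset of `X`. -/
def TieBreakRule (M : MultiStageProgram d N Δ) : Prop :=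
  (∀ j, ConvexOn ℝ Set.univ (M.tieBreak j)) ∧
    ∀ C ⊆ M.X, IsCompact C → Convex ℝ C →
      ∀ x y, M.IsOptimal C x → M.IsOptimal C y → x = y

/-- Feasible set of the sampled program, for the multi-sample `ω` with `K i` samples in
stage `i`. -/
def feasibleSet (M : MultiStageProgram d N Δ) {K : Fin N → ℕ} (ω : ∀ i, Fin (K i) → Δ) :
    Set (EuclideanSpace ℝ (Fin d)) :=
  {x | x ∈ M.X ∧ ∀ i κ, M.f i x (ω i κ) ≤ 0}

open Classical in
/-- The solution map: the optimal point of the sampled program (`0` if there is none). -/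
noncomputable def solution (M : MultiStageProgram d N Δ) {K : Fin N → ℕ}
    (ω : ∀ i, Fin (K i) → Δ) : EuclideanSpace ℝ (Fin d) :=
  if h : ∃ x, M.IsOptimal (M.feasibleSet ω) x then h.choose else 0

/-- The joint law of the multi-samples: `K i` samples for each stage `i`, all independent with
law `P`. -/
noncomputable def sampleMeasure [MeasurableSpace Δ] (P : Measure Δ) (K : Fin N → ℕ) :
    Measure (∀ i, Fin (K i) → Δ) :=
  Measure.pi fun i => Measure.pi fun _ : Fin (K i) => P

/-- Violation probability of stage `i` at the solution for the multi-sample `ω`. -/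
noncomputable def violationProb [MeasurableSpace Δ] (M : MultiStageProgram d N Δ) (P : Measure Δ)
    (i : Fin N) {K : Fin N → ℕ} (ω : ∀ i, Fin (K i) → Δ) : ℝ :=
  P.real {δ | 0 < M.f i (M.solution ω) δ}

/-- The level set of stage `i` through `x`, translated to the origin. -/
def levelSet (M : MultiStageProgram d N Δ) (i : Fin N) (x : EuclideanSpace ℝ (Fin d)) (δ : Δ) :
    Set (EuclideanSpace ℝ (Fin d)) :=
  {ξ | M.f i (x + ξ) δ = M.f i x δ}

/-- The linear subspaces contained in all level sets of stage `i`, up to a `P`-null set of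
uncertainties. -/
def unconstrained [MeasurableSpace Δ] (M : MultiStageProgram d N Δ) (P : Measure Δ) (i : Fin N) :
    Set (Submodule ℝ (EuclideanSpace ℝ (Fin d))) :=
  {L | ∀ᵐ δ ∂P, ∀ x ∈ M.X, (L : Set (EuclideanSpace ℝ (Fin d))) ⊆ M.levelSet i x δ}

/-- The unconstrained subspace of stage `i`: the largest element of `M.unconstrained P i`
(see `isGreatest_unconstrainedSubspace`). -/
noncomputable def unconstrainedSubspace [MeasurableSpace Δ] (M : MultiStageProgram d N Δ)
    (P : Measure Δ) (i : Fin N) : Submodule ℝ (EuclideanSpace ℝ (Fin d)) :=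
  sSup (M.unconstrained P i)

/-- The support rank of stage `i`. -/
noncomputable def supportRank [MeasurableSpace Δ] (M : MultiStageProgram d N Δ) (P : Measure Δ)
    (i : Fin N) : ℕ :=
  d - Module.finrank ℝ (M.unconstrainedSubspace P i)

/-- A real convex function that is constant on one line is invariant in the direction of it. -/
theorem convex_invariant {g : EuclideanSpace ℝ (Fin d) → ℝ} (hg : ConvexOn ℝ Set.univ g)
    {x ξ : EuclideanSpace ℝ (Fin d)} (h : ∀ s : ℝ, g (x + s • ξ) = g x)
    (y : EuclideanSpace ℝ (Fin d)) : g (y + ξ) = g y := by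
  have hc : Continuous g := by
    rw [← continuousOn_univ]
    exact hg.continuousOn isOpen_univ
  have key : ∀ (ζ : EuclideanSpace ℝ (Fin d)), (∀ s : ℝ, g (x + s • ζ) = g x) →
      ∀ y, g (y + ζ) ≤ g y := by
    intro ζ hζ y
    have h1 : Filter.Tendsto (fun a : ℝ => g (y + ζ + a • (x - y))) (nhdsWithin 0 (Set.Ioi 0))
        (nhds (g (y + ζ))) := by
      have : Continuous fun a : ℝ => g (y + ζ + a • (x - y)) := by fun_prop
      have h := this.tendsto 0
      simp only [zero_smul, add_zero] at h
      exact h.mono_left nhdsWithin_le_nhds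
    have h2 : Filter.Tendsto (fun a : ℝ => (1 - a) * g y + a * g x) (nhdsWithin 0 (Set.Ioi 0))
        (nhds (g y)) := by
      have : Continuous fun a : ℝ => (1 - a) * g y + a * g x := by fun_prop
      have h := this.tendsto 0
      simp only [sub_zero, one_mul, zero_mul, add_zero] at h
      exact h.mono_left nhdsWithin_le_nhds
    refine le_of_tendsto_of_tendsto h1 h2 ?_
    have hm : Set.Ioo (0 : ℝ) 1 ∈ nhdsWithin (0 : ℝ) (Set.Ioi 0) :=
      Ioo_mem_nhdsGT one_pos
    filter_upwards [hm] with a ha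
    have hcv := hg.2 (Set.mem_univ y) (Set.mem_univ (x + a⁻¹ • ζ))
      (sub_nonneg.2 ha.2.le) ha.1.le (by ring)
    have he : (1 - a) • y + a • (x + a⁻¹ • ζ) = y + ζ + a • (x - y) := by
      rw [smul_add, smul_smul, mul_inv_cancel₀ ha.1.ne', one_smul]
      module
    rw [he, hζ] at hcv
    simpa using hcv
  refine le_antisymm (key ξ h y) ?_
  have := key (-ξ) (fun s => by simpa using h (-s)) (y + ξ)
  simpa using this

/-- Well-definedness of the unconstrained subspace. -/
theorem isGreatest_unconstrainedSubspace [MeasurableSpace Δ] (M : MultiStageProgram d N Δ)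
    (P : Measure Δ) (i : Fin N) (hX : M.X.Nonempty)
    (hf : ∀ᵐ δ ∂P, ConvexOn ℝ Set.univ fun x => M.f i x δ) :
    IsGreatest (M.unconstrained P i) (M.unconstrainedSubspace P i) := by
  have hsup : ∀ A ∈ M.unconstrained P i, ∀ B ∈ M.unconstrained P i,
      A ⊔ B ∈ M.unconstrained P i := by
    intro A hA B hB
    obtain ⟨x₀, hx₀⟩ := hX
    change ∀ᵐ δ ∂P, ∀ x ∈ M.X, ((A ⊔ B : Submodule ℝ _) : Set _) ⊆ M.levelSet i x δ
    change ∀ᵐ δ ∂P, ∀ x ∈ M.X, (A : Set _) ⊆ M.levelSet i x δ at hA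
    change ∀ᵐ δ ∂P, ∀ x ∈ M.X, (B : Set _) ⊆ M.levelSet i x δ at hB
    filter_upwards [hf, hA, hB] with δ hδ hAδ hBδ x hx ξ hξ
    obtain ⟨a, ha, b, hb, rfl⟩ := Submodule.mem_sup.1 hξ
    have hb' := convex_invariant hδ (x := x) (ξ := b)
      (fun s => hBδ x hx (B.smul_mem s hb)) (x + a)
    have ha' : M.f i (x + a) δ = M.f i x δ := hAδ x hx ha
    change M.f i (x + (a + b)) δ = M.f i x δ
    rw [← add_assoc]
    exact hb'.trans ha'
  have hbot : ⊥ ∈ M.unconstrained P i := by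
    change ∀ᵐ δ ∂P, ∀ x ∈ M.X, ((⊥ : Submodule ℝ (EuclideanSpace ℝ (Fin d))) : Set (EuclideanSpace ℝ (Fin d))) ⊆ M.levelSet i x δ
    refine Filter.Eventually.of_forall fun δ x _ ξ hξ => ?_
    have : ξ = 0 := by simpa using hξ
    simp [levelSet, this]
  obtain ⟨A, hA, hmax⟩ := (wellFounded_gt
    (α := Submodule ℝ (EuclideanSpace ℝ (Fin d)))).has_min (M.unconstrained P i) ⟨⊥, hbot⟩
  have hgr : IsGreatest (M.unconstrained P i) A := by
    refine ⟨hA, fun B hB => ?_⟩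
    by_contra hBA
    exact hmax _ (hsup A hA B hB) (left_lt_sup.2 hBA)
  have : M.unconstrainedSubspace P i = A := hgr.isLUB.sSup_eq
  rw [this]
  exact hgr

end MultiStageProgram

/-- The binomial distribution function: the probability of at most `x` successes in `K` independent
trials of success probability `ε` (the empty sum for `x = -1`). -/
noncomputable def binomialCDF (x : ℤ) (K : ℕ) (ε : ℝ) : ℝ :=
  ∑ j ∈ Finset.range (x + 1).toNat, (K.choose j : ℝ) * ε ^ j * (1 - ε) ^ (K - j)

/-! Fix stage `i`, put n = K_i and k = ζ_i, and draw m further samples of this stage. By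
exchangeability, the probability that at least s = ⌈εm⌉ of them violate the solution is the expected
fraction of the n-subsets R of the n + m samples whose solution is violated by at least s samples
outside R. It suffices to bound their number for a fixed multi-sample and let m → ∞: the weak law of
large numbers and Fatou's lemma recover the event V_i > ε, and the hypergeometric bound tends to the
binomial tail.

The count rests on an interval selection: a map I with I(G) ⊆ G and #I(G) ≤ k whose fibres are
intervals, and whose value changes whenever a violated constraint is added. After ordering the
samples, every R with at least k elements lies in exactly one interval [J, J ∪ free(J)] with #J = k.
Counting sets of each size shows that all binomial moments of #free(J), hence its distribution over
J, do not depend on I (`sum_choose_free`, `sum_eq_of_binomial_moments_eq`). Violated samples lie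
outside J ∪ free(J), so they force free(J) to be small. Comparison with the trivial selection I = ∅
leaves only the R with fewer than k elements among the first s + k - 1 (`card_filter_viol_le`).

A selection must exist without any non-degeneracy. For a strictly convex coercive objective, a
generic small relaxation of the constraints makes the support constraints alone determine the
minimum; Helly's theorem bounds their number and uniqueness of the minimizer gives intervals
(`exists_selection_of_relaxation`). Whether a candidate z is optimal is the question whether convex
constraints meet the convex set of better points, which distances to polytopes turn into such a
minimization (`exists_selection_of_convex`). This is done in the orthogonal complement of the
unconstrained subspace, of dimension k, and the selections for the various z are glued along the
solution map (`exists_selection_of_constraints`). -/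

/-! ### Counting subsets by means of interval selections -/

section Counting

open Finset

/-- Two finite families of natural numbers with the same binomial moments have the same
distribution. -/
theorem sum_eq_of_binomial_moments_eq {ι : Type*} (s : Finset ι) (a b : ι → ℕ)
    (h : ∀ m, ∑ i ∈ s, (a i).choose m = ∑ i ∈ s, (b i).choose m) (f : ℕ → ℕ) :
    ∑ i ∈ s, f (a i) = ∑ i ∈ s, f (b i) := by
  set F : ℕ → ℤ := fun x => f x
  set B : ℕ := s.sup a + s.sup b + 1
  -- Newton's forward difference formula: on [0, B) every function is a combination of binomial
  -- coefficients, so the binomial moments determine all sums.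
  have key : ∀ x < B, F x = ∑ m ∈ range B, (x.choose m : ℤ) * ((fwdDiff 1)^[m] F 0) := by
    intro x hx
    have h1 := shift_eq_sum_fwdDiff_iter (h := (1 : ℕ)) F x 0
    simp only [smul_eq_mul, mul_one, zero_add, nsmul_eq_mul] at h1
    rw [h1]
    refine sum_subset (range_subset_range.2 (by omega)) fun m _ hm => ?_
    rw [Nat.choose_eq_zero_of_lt (by simpa using hm)]
    simp
  have ha : ∀ i ∈ s, a i < B := fun i hi => by
    have := le_sup (f := a) hi
    omega
  have hb : ∀ i ∈ s, b i < B := fun i hi => by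
    have := le_sup (f := b) hi
    omega
  have : ∑ i ∈ s, F (a i) = ∑ i ∈ s, F (b i) := by
    rw [sum_congr rfl fun i hi => key _ (ha i hi), sum_congr rfl fun i hi => key _ (hb i hi),
      sum_comm, sum_comm (s := s)]
    refine sum_congr rfl fun m _ => ?_
    rw [← sum_mul, ← sum_mul]
    congr 1
    exact_mod_cast h m
  simp only [F] at this
  exact_mod_cast this

theorem Finset.exists_initial_segment {α : Type*} [LinearOrder α] (A : Finset α)
    {r : ℕ} (hr : r ≤ #A) :
    ∃ F ⊆ A, #F = r ∧ ∀ x ∈ F, ∀ y ∈ A \ F, x < y := by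
  induction r with
  | zero => exact ⟨∅, by simp⟩
  | succ r ih =>
    obtain ⟨F, hF, hc, hlt⟩ := ih (by omega)
    have hne : (A \ F).Nonempty := by
      rw [← card_pos, card_sdiff_of_subset hF]
      omega
    have hm := min'_mem _ hne
    refine ⟨insert ((A \ F).min' hne) F, ?_, ?_, ?_⟩
    · exact insert_subset (mem_sdiff.1 hm).1 hF
    · rw [card_insert_of_notMem (mem_sdiff.1 hm).2, hc]
    · intro x hx y hy
      rw [mem_sdiff, mem_insert, not_or] at hy
      have hyA : y ∈ A \ F := mem_sdiff.2 ⟨hy.1, hy.2.2⟩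
      rcases mem_insert.1 hx with rfl | hx
      · exact lt_of_le_of_ne (min'_le _ _ hyA) (Ne.symm hy.2.1)
      · exact hlt x hx y hyA

/-- A map on finite sets that picks a subset of at most `k` elements, and all of whose fibres are
intervals `[I G, W]`. -/
structure IsIntervalSelection {α : Type*} [DecidableEq α] (k : ℕ) (I : Finset α → Finset α) :
    Prop where
  subset : ∀ G, I G ⊆ G
  card_le : ∀ G, #(I G) ≤ k
  eq_of_between : ∀ G H, I G ⊆ H → H ⊆ G → I H = I G
  union : ∀ G G', I G = I G' → I (G ∪ G') = I G

theorem isIntervalSelection_empty {α : Type*} [DecidableEq α] (k : ℕ) :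
    IsIntervalSelection k (fun _ : Finset α => ∅) :=
  ⟨by simp, by simp, by simp, by simp⟩

namespace IsIntervalSelection

variable {α : Type*} [Fintype α] [LinearOrder α] {k : ℕ} {I : Finset α → Finset α}

/-- The elements that may be added to `J` without changing the selection, and that come after
all the non-selected elements of `J`. -/
def free (I : Finset α → Finset α) (J : Finset α) : Finset α :=
  univ.filter fun g => g ∉ J ∧ I (insert g J) = I J ∧ ∀ j ∈ J \ I J, j < g

theorem mem_free {J : Finset α} {g : α} :
    g ∈ free I J ↔ g ∉ J ∧ I (insert g J) = I J ∧ ∀ j ∈ J \ I J, j < g := by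
  simp [free]

theorem disjoint_free (I : Finset α → Finset α) (J : Finset α) : Disjoint J (free I J) := by
  rw [Finset.disjoint_left]
  intro a ha hb
  exact (mem_free.1 hb).1 ha

theorem union_free (hI : IsIntervalSelection k I) {J S : Finset α} (hS : S ⊆ free I J) :
    I (J ∪ S) = I J := by
  induction S using Finset.induction_on with
  | empty => simp
  | insert g S hg ih =>
    have h1 := ih ((subset_insert _ _).trans hS)
    have h2 := (mem_free.1 (hS (mem_insert_self _ _))).2.1
    have h3 : J ∪ insert g S = insert g J ∪ (J ∪ S) := by
      ext x; simp only [mem_union, mem_insert]; tauto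
    rw [h3, hI.union _ _ (h2.trans h1.symm), h2]

theorem eq_of_interval (hI : IsIntervalSelection k I) {J R : Finset α} (h1 : J ⊆ R)
    (h2 : R ⊆ J ∪ free I J) : I R = I J := by
  have : R = J ∪ (R \ J) := by rw [union_sdiff_of_subset h1]
  rw [this]
  refine hI.union_free fun x hx => ?_
  have := h2 (mem_sdiff.1 hx).1
  simp only [mem_union] at this
  exact this.resolve_left (mem_sdiff.1 hx).2

/-- If J and J' differed, some a ∈ J \ J' and b ∈ J' \ J would both lie outside the common
selection. Then a is free for J' and comes after b, while b is free for J and comes after a. -/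
theorem interval_unique (hI : IsIntervalSelection k I) {J J' R : Finset α} (hJ : #J = k)
    (hJ' : #J' = k) (h1 : J ⊆ R) (h2 : R ⊆ J ∪ free I J) (h1' : J' ⊆ R)
    (h2' : R ⊆ J' ∪ free I J') : J = J' := by
  have e : I J = I J' := by rw [← hI.eq_of_interval h1 h2, hI.eq_of_interval h1' h2']
  by_contra hne
  have ha : ¬ J ⊆ J' := fun h => hne (eq_of_subset_of_card_le h (by omega))
  have hb : ¬ J' ⊆ J := fun h => hne (eq_of_subset_of_card_le h (by omega)).symm
  obtain ⟨a, haJ, haJ'⟩ := not_subset.1 ha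
  obtain ⟨b, hbJ', hbJ⟩ := not_subset.1 hb
  have hfa : a ∈ free I J' := (mem_union.1 (h2' (h1 haJ))).resolve_left haJ'
  have hfb : b ∈ free I J := (mem_union.1 (h2 (h1' hbJ'))).resolve_left hbJ
  have l1 := (mem_free.1 hfa).2.2 b (mem_sdiff.2 ⟨hbJ', fun h => hbJ (hI.subset J (e ▸ h))⟩)
  have l2 := (mem_free.1 hfb).2.2 a (mem_sdiff.2 ⟨haJ, fun h => haJ' (hI.subset J' (e ▸ h))⟩)
  exact lt_asymm l1 l2

/-- J consists of `I R` and the first `k - #(I R)` elements of `R \ I R`; the later elements of R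
are then free. -/
theorem exists_interval (hI : IsIntervalSelection k I) {R : Finset α} (hR : k ≤ #R) :
    ∃ J, #J = k ∧ J ⊆ R ∧ R ⊆ J ∪ free I J := by
  have hcR := card_sdiff_of_subset (hI.subset R)
  have hck := hI.card_le R
  obtain ⟨F, hF, hFc, hlt⟩ := Finset.exists_initial_segment (R \ I R) (r := k - #(I R)) (by omega)
  have hJR : I R ∪ F ⊆ R := union_subset (hI.subset R) (hF.trans sdiff_subset)
  have hIJ : I (I R ∪ F) = I R := hI.eq_of_between _ _ subset_union_left hJR
  refine ⟨I R ∪ F, ?_, hJR, ?_⟩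
  · rw [card_union_of_disjoint, hFc]
    · omega
    · exact disjoint_sdiff.mono_right hF
  · intro x hx
    by_cases hxJ : x ∈ I R ∪ F
    · exact mem_union_left _ hxJ
    · refine mem_union_right _ (mem_free.2 ⟨hxJ, ?_, ?_⟩)
      · rw [hIJ]
        refine hI.eq_of_between _ _ ?_ (insert_subset hx hJR)
        exact subset_union_left.trans (subset_insert _ _)
      · intro j hj
        rw [hIJ, mem_sdiff, mem_union] at hj
        refine hlt j (hj.1.resolve_left hj.2) x ?_
        simp only [mem_union, not_or] at hxJ
        exact mem_sdiff.2 ⟨mem_sdiff.2 ⟨hx, hxJ.1⟩, hxJ.2⟩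

/-- The sets of `k + m` elements in the interval `[J, J ∪ free I J]`. -/
def block (I : Finset α → Finset α) (m : ℕ) (J : Finset α) : Finset (Finset α) :=
  (powersetCard m (free I J)).image (J ∪ ·)

theorem card_block (I : Finset α → Finset α) (m : ℕ) (J : Finset α) :
    #(block I m J) = (#(free I J)).choose m := by
  rw [block, card_image_of_injOn, card_powersetCard]
  intro S hS S' hS' h
  have d := disjoint_free I J
  have hS := (mem_powersetCard.1 hS).1
  have hS' := (mem_powersetCard.1 hS').1
  have h : J ∪ S = J ∪ S' := h
  have e1 : (J ∪ S) \ J = S := union_sdiff_cancel_left (d.mono_right hS)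
  have e2 : (J ∪ S') \ J = S' := union_sdiff_cancel_left (d.mono_right hS')
  rw [← e1, h, e2]

theorem mem_block {m : ℕ} {J R : Finset α} (hJ : #J = k) :
    R ∈ block I m J ↔ #R = k + m ∧ J ⊆ R ∧ R ⊆ J ∪ free I J := by
  have d := disjoint_free I J
  constructor
  · intro h
    obtain ⟨S, hS, rfl⟩ := mem_image.1 h
    obtain ⟨hS, hc⟩ := mem_powersetCard.1 hS
    exact ⟨by rw [card_union_of_disjoint (d.mono_right hS), hJ, hc], subset_union_left,
      union_subset_union_right hS⟩
  · rintro ⟨hc, h1, h2⟩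
    refine mem_image.2 ⟨R \ J, mem_powersetCard.2 ⟨?_, ?_⟩, union_sdiff_of_subset h1⟩
    · intro x hx
      exact (mem_union.1 (h2 (mem_sdiff.1 hx).1)).resolve_left (mem_sdiff.1 hx).2
    · rw [card_sdiff_of_subset h1, hc, hJ]
      omega

theorem pairwiseDisjoint_block (hI : IsIntervalSelection k I) (m : ℕ) {s : Finset (Finset α)}
    (hs : ∀ J ∈ s, #J = k) : (s : Set (Finset α)).PairwiseDisjoint (block I m) := by
  intro J hJ J' hJ' hne
  rw [Function.onFun, Finset.disjoint_left]
  intro R h h'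
  rw [mem_block (hs J hJ)] at h
  rw [mem_block (hs J' hJ')] at h'
  exact hne (hI.interval_unique (hs J hJ) (hs J' hJ') h.2.1 h.2.2 h'.2.1 h'.2.2)

/-- The intervals [J, J ∪ free J] partition the sets of k + m elements. The right side does not
involve I: the binomial moments of `#(free I J)` are the same for all selections. -/
theorem sum_choose_free (hI : IsIntervalSelection k I) (m : ℕ) :
    ∑ J ∈ powersetCard k (univ : Finset α), (#(free I J)).choose m =
      (Fintype.card α).choose (k + m) := by
  have hk : ∀ J ∈ powersetCard k (univ : Finset α), #J = k := fun J hJ =>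
    (mem_powersetCard.1 hJ).2
  rw [← sum_congr rfl fun J _ => card_block I m J, ← card_biUnion (hI.pairwiseDisjoint_block m hk),
    ← card_univ, ← card_powersetCard]
  congr 1
  ext R
  simp only [mem_biUnion, mem_powersetCard, subset_univ, true_and]
  constructor
  · rintro ⟨J, hJ, h⟩
    exact ((mem_block hJ).1 h).1
  · intro h
    obtain ⟨J, hJ, h1, h2⟩ := hI.exists_interval (R := R) (by omega)
    exact ⟨J, hJ, (mem_block hJ).2 ⟨h, h1, h2⟩⟩

/-- Among the `n`-element subsets, those with at least `s` elements that affect the selection are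
not more numerous than those with fewer than `k` elements among the first `s + k - 1` elements. -/
theorem card_filter_viol_le {M : ℕ} {I : Finset (Fin M) → Finset (Fin M)}
    (hI : IsIntervalSelection k I) (viol : Finset (Fin M) → Finset (Fin M))
    (hviol : ∀ G, ∀ t ∈ viol G, I (insert t G) ≠ I G) (n s : ℕ) (hs : 1 ≤ s) :
    #{R ∈ powersetCard n (univ : Finset (Fin M)) | s ≤ #(viol R)} ≤
      #((powersetCard n (univ : Finset (Fin M))).filter fun R =>
        #(R.filter fun t : Fin M => t.val < s + k - 1) < k) := by
  rcases lt_or_ge n k with hnk | hnk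
  · refine card_le_card fun R hR => mem_filter.2 ⟨(mem_filter.1 hR).1, ?_⟩
    have := (mem_powersetCard.1 (mem_filter.1 hR).1).2
    exact (Finset.card_filter_le R _).trans_lt (by omega)
  obtain ⟨m, rfl⟩ := Nat.exists_eq_add_of_le hnk
  have hk : ∀ {p : Finset (Fin M) → Prop} [DecidablePred p],
      ∀ J ∈ (powersetCard k (univ : Finset (Fin M))).filter p, #J = k := fun J hJ =>
    (mem_powersetCard.1 (mem_filter.1 hJ).1).2
  -- The trivial selection serves for comparison: here `free I₀ J` consists of the elements later
  -- than all of J, so J is the initial segment of each set in its block.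
  set I₀ : Finset (Fin M) → Finset (Fin M) := fun _ => ∅ with hI₀
  have hI₀s : IsIntervalSelection k I₀ := isIntervalSelection_empty k
  calc #{R ∈ powersetCard (k + m) (univ : Finset (Fin M)) | s ≤ #(viol R)}
      ≤ #({J ∈ powersetCard k (univ : Finset (Fin M)) | #(free I J) + k + s ≤ M}.biUnion
          (block I m)) := by
        refine card_le_card fun R hR => ?_
        rw [mem_filter, mem_powersetCard] at hR
        obtain ⟨J, hJ, h1, h2⟩ := hI.exists_interval (R := R) (by omega)
        refine mem_biUnion.2 ⟨J, mem_filter.2 ⟨mem_powersetCard.2 ⟨subset_univ _, hJ⟩, ?_⟩,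
          (mem_block hJ).2 ⟨hR.1.2, h1, h2⟩⟩
        have hd : Disjoint (viol R) (J ∪ free I J) := by
          rw [Finset.disjoint_left]
          intro t ht htJ
          refine hviol R t ht ?_
          rw [hI.eq_of_interval h1 h2]
          exact hI.eq_of_interval (h1.trans (subset_insert _ _)) (insert_subset htJ h2)
        have := card_le_univ (viol R ∪ (J ∪ free I J))
        rw [card_union_of_disjoint hd, card_union_of_disjoint (disjoint_free I J), hJ,
          Fintype.card_fin] at this
        omega
    _ = ∑ J ∈ powersetCard k (univ : Finset (Fin M)),
          (if #(free I J) + k + s ≤ M then (#(free I J)).choose m else 0) := by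
        rw [card_biUnion (hI.pairwiseDisjoint_block m hk), sum_filter]
        simp only [card_block]
    _ = ∑ J ∈ powersetCard k (univ : Finset (Fin M)),
          (if #(free I₀ J) + k + s ≤ M then (#(free I₀ J)).choose m else 0) :=
        sum_eq_of_binomial_moments_eq _ (fun J => #(free I J)) (fun J => #(free I₀ J))
          (fun m' => by rw [hI.sum_choose_free, hI₀s.sum_choose_free])
          (fun x => if x + k + s ≤ M then x.choose m else 0)
    _ = #({J ∈ powersetCard k (univ : Finset (Fin M)) | #(free I₀ J) + k + s ≤ M}.biUnion
          (block I₀ m)) := by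
        rw [card_biUnion (hI₀s.pairwiseDisjoint_block m hk), sum_filter]
        simp only [card_block]
    _ ≤ _ := by
        refine card_le_card fun R hR => ?_
        obtain ⟨J, hJ, hR⟩ := mem_biUnion.1 hR
        have hJk := hk J hJ
        rw [mem_block hJk] at hR
        have hle := (mem_filter.1 hJ).2
        refine mem_filter.2 ⟨mem_powersetCard.2 ⟨subset_univ _, hR.1⟩, ?_⟩
        -- Otherwise J, the first k elements of R, lies below s + k - 1, and every position from
        -- there on is free. This is one free element more than `hle` permits.
        by_contra! hlt
        have hJsub : ∀ j ∈ J, (j : ℕ) < s + k - 1 := by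
          intro j hj
          by_contra! hjge
          have hsub : (R.filter fun t : Fin M => t.val < s + k - 1) ⊆ J.erase j := by
            intro t ht
            rw [mem_filter] at ht
            have htj : t < j := Fin.lt_def.2 (by omega)
            refine mem_erase.2 ⟨htj.ne, ?_⟩
            refine (mem_union.1 (hR.2.2 ht.1)).resolve_right fun hf => ?_
            exact lt_asymm htj ((mem_free.1 hf).2.2 j (by simpa [hI₀] using hj))
          have := card_le_card hsub
          rw [card_erase_of_mem hj] at this
          have := card_pos.2 ⟨j, hj⟩
          omega
        have hcov : (univ : Finset (Fin M)) ⊆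
            free I₀ J ∪ univ.filter (fun t : Fin M => t.val < s + k - 1) := by
          intro t _
          rw [mem_union, mem_filter]
          by_cases ht : (t : ℕ) < s + k - 1
          · exact Or.inr ⟨mem_univ _, ht⟩
          · refine Or.inl (mem_free.2 ⟨fun htJ => ht (hJsub t htJ), rfl, ?_⟩)
            intro j hj
            have := hJsub j (mem_sdiff.1 hj).1
            exact Fin.lt_def.2 (by omega)
        have h1 := (card_le_card hcov).trans (card_union_le _ _)
        have h2 : #(univ.filter (fun t : Fin M => t.val < s + k - 1)) ≤ s + k - 1 := by
          refine (card_le_card_of_injOn (t := range (s + k - 1)) (fun t => t.val) ?_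
            (Fin.val_injective.injOn)).trans (card_range _).le
          intro t ht
          simpa using ht
        rw [card_univ, Fintype.card_fin] at h1
        omega

end IsIntervalSelection

end Counting

/-! ### Support constraints after a generic relaxation -/

section Selection

open Finset Filter Topology Module

/-- If a convex function on the positive orthant is differentiable at `p` and constant from `p` on in
each of the coordinate directions of `J`, then it is bounded below by its value at `p` in the
direction of their sum. -/
theorem ConvexOn.le_add_of_constant_directions {τ : Type*} [Fintype τ] [DecidableEq τ]
    {v : (τ → ℝ) → ℝ}
    (hv : ConvexOn ℝ {η | ∀ t, 0 < η t} v) {p : τ → ℝ} (hp : ∀ t, 0 < p t)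
    (hd : DifferentiableAt ℝ v p) {J : Finset τ}
    (hJ : ∀ j ∈ J, ∀ r : ℝ, 0 ≤ r → v (p + r • Pi.single j 1) = v p) {r : ℝ} (hr : 0 < r) :
    v p ≤ v (p + r • ∑ j ∈ J, Pi.single j (1 : ℝ)) := by
  have line : ∀ u : τ → ℝ, HasDerivAt (fun r : ℝ => v (p + r • u)) (fderiv ℝ v p u) 0 := by
    intro u
    have h1 : HasDerivAt (fun r : ℝ => p + r • u) u 0 := by
      simpa using ((hasDerivAt_id (0 : ℝ)).smul_const u).const_add p
    have h2 : HasFDerivAt v (fderiv ℝ v p) (p + (0 : ℝ) • u) := by simpa using hd.hasFDerivAt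
    exact h2.comp_hasDerivAt (0 : ℝ) h1
  -- Constancy on a half-line makes the directional derivative vanish. Differentiability is what
  -- carries this over, by linearity, from the single directions to their sum.
  have hzero : ∀ j ∈ J, fderiv ℝ v p (Pi.single j 1) = 0 := by
    intro j hj
    refine (uniqueDiffOn_Ici (0 : ℝ) 0 Set.self_mem_Ici).eq_deriv _ (line _).hasDerivWithinAt ?_
    refine (hasDerivWithinAt_const (0 : ℝ) _ (v p)).congr (fun r hr => hJ j hj r hr) ?_
    simp
  set u : τ → ℝ := ∑ j ∈ J, Pi.single j (1 : ℝ)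
  have hu : ∀ t, 0 ≤ u t := by
    intro t
    simp only [u, Finset.sum_apply]
    refine sum_nonneg fun j _ => ?_
    rcases eq_or_ne t j with rfl | h
    · simp
    · simp [Pi.single_eq_of_ne h]
  have hzu : fderiv ℝ v p u = 0 := by
    simp only [u, map_sum]
    exact sum_eq_zero hzero
  have hconv : ConvexOn ℝ (Set.Ici (0 : ℝ)) (fun r : ℝ => v (p + r • u)) := by
    refine ⟨convex_Ici 0, fun a ha b hb x y hx hy hxy => ?_⟩
    have hmem : ∀ r : ℝ, 0 ≤ r → p + r • u ∈ {η : τ → ℝ | ∀ t, 0 < η t} := by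
      intro r hr t
      have := mul_nonneg hr (hu t)
      have := hp t
      simp only [Pi.add_apply, Pi.smul_apply, smul_eq_mul]
      linarith
    have h := hv.2 (hmem a ha) (hmem b hb) hx hy hxy
    have e : x • (p + a • u) + y • (p + b • u) = p + (x • a + y • b) • u := by
      have : p = (x + y) • p := by rw [hxy, one_smul]
      nth_rewrite 3 [this]
      simp only [smul_eq_mul]
      module
    rwa [e] at h
  have := hconv.le_slope_of_hasDerivWithinAt Set.self_mem_Ici hr.le hr (line u).hasDerivWithinAt
  rw [hzu, slope_def_field, zero_smul, add_zero, sub_zero] at this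
  have := mul_nonneg this hr.le
  rw [div_mul_cancel₀ _ hr.ne'] at this
  linarith

/-- Finitely many convex functions on the positive orthant are simultaneously differentiable at some
point of any cube at the origin. -/
theorem exists_differentiableAt_of_convexOn {τ : Type*} [Fintype τ] {κ : Type*} [Finite κ]
    (v : κ → (τ → ℝ) → ℝ)
    (hv : ∀ G, ConvexOn ℝ {η | ∀ t, 0 < η t} (v G)) {δ : ℝ} (hδ : 0 < δ) :
    ∃ p : τ → ℝ, (∀ t, 0 < p t ∧ p t < δ) ∧ ∀ G, DifferentiableAt ℝ (v G) p := by
  have hopen : IsOpen {η : τ → ℝ | ∀ t, 0 < η t} := by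
    simp only [Set.ofPred_forall]
    exact isOpen_iInter_of_finite fun t => isOpen_lt continuous_const (continuous_apply t)
  have hcube : IsOpen {η : τ → ℝ | ∀ t, 0 < η t ∧ η t < δ} := by
    simp only [Set.ofPred_forall]
    refine isOpen_iInter_of_finite fun t => ?_
    exact (isOpen_lt continuous_const (continuous_apply t)).inter
      (isOpen_lt (continuous_apply t) continuous_const)
  -- Near the centre of the cube the convex functions are Lipschitz, so Rademacher's theorem applies
  -- to all of them at once.
  set c : τ → ℝ := fun _ => δ / 2
  have hc : ∀ t, 0 < c t ∧ c t < δ := fun t => ⟨half_pos hδ, half_lt_self hδ⟩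
  have hlip : ∀ G, ∃ K, ∃ s ∈ 𝓝 c, LipschitzOnWith K (v G) s := by
    intro G
    obtain ⟨K, s, hs, h⟩ := (hv G).locallyLipschitzOn hopen (x := c) (fun t => (hc t).1)
    rw [hopen.nhdsWithin_eq (fun t => (hc t).1)] at hs
    exact ⟨K, s, hs, h⟩
  choose K s hs hK using hlip
  set U : Set (τ → ℝ) := interior (⋂ G, s G) ∩ {η : τ → ℝ | ∀ t, 0 < η t ∧ η t < δ}
  have hUo : IsOpen U := isOpen_interior.inter hcube
  have hcU : c ∈ U := ⟨mem_interior_iff_mem_nhds.2 (iInter_mem.2 hs), hc⟩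
  have hae : ∀ᵐ p : τ → ℝ, ∀ G, p ∈ U → DifferentiableWithinAt ℝ (v G) U p := by
    rw [ae_all_iff]
    intro G
    refine LipschitzOnWith.ae_differentiableWithinAt_of_mem ((hK G).mono ?_)
    exact Set.inter_subset_left.trans (interior_subset.trans (Set.iInter_subset _ G))
  have hpos : volume U ≠ 0 := (hUo.measure_pos volume ⟨c, hcU⟩).ne'
  obtain ⟨p, hpU, hp⟩ : ∃ p ∈ U, ∀ G, p ∈ U → DifferentiableWithinAt ℝ (v G) U p := by
    by_contra! hcon
    refine hpos (measure_mono_null (fun p hp => ?_) (ae_iff.1 hae))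
    obtain ⟨G, h1, h2⟩ := hcon p hp
    exact fun h => h2 (h G h1)
  exact ⟨p, hpU.2, fun G => (hp G hpU).differentiableAt (hUo.mem_nhds hpU)⟩

/-- The problems of minimizing a strictly convex coercive function subject to convex constraints
become non-degenerate after a generic small relaxation of the constraints. -/
theorem exists_selection_of_relaxation {τ : Type*} [Fintype τ] [DecidableEq τ] {V : Type*}
    [NormedAddCommGroup V] [NormedSpace ℝ V] [FiniteDimensional ℝ V] (g : τ → V → ℝ) (hg : ∀ t, ConvexOn ℝ Set.univ (g t))
    (hgc : ∀ t, Continuous (g t)) (w : V → ℝ) (hw : StrictConvexOn ℝ Set.univ w)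
    (hwc : Continuous w) (hwt : Tendsto w (cocompact V) atTop) (x : V) (hx : ∀ t, g t x ≤ 0)
    {δ : ℝ} (hδ : 0 < δ) :
    ∃ (η : τ → ℝ) (m : Finset τ → ℝ) (I : Finset τ → Finset τ), (∀ t, 0 < η t ∧ η t < δ) ∧
      (∀ G, IsLeast (w '' {q | ∀ t ∈ G, g t q ≤ η t}) (m G)) ∧
      IsIntervalSelection (finrank ℝ V) I ∧ ∀ G, m (I G) = m G := by
  set F : Finset τ → (τ → ℝ) → Set V := fun G η => {q | ∀ t ∈ G, g t q ≤ η t} with hF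
  have hmin : ∀ G (η : τ → ℝ), (∀ t, 0 < η t) → ∃ q ∈ F G η, IsMinOn w (F G η) q := by
    intro G η hη
    have hcl : IsClosed (F G η) := by
      have : F G η = ⋂ t ∈ G, {q | g t q ≤ η t} := by ext q; simp [hF]
      rw [this]
      exact isClosed_biInter fun t _ => isClosed_le (hgc t) continuous_const
    have hxF : x ∈ F G η := fun t _ => (hx t).trans (hη t).le
    refine hwc.continuousOn.exists_isMinOn' hcl hxF ?_
    exact (hwt.eventually_ge_atTop (w x)).filter_mono inf_le_left
  set v : Finset τ → (τ → ℝ) → ℝ := fun G η => sInf (w '' F G η) with hv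
  have hleast : ∀ G (η : τ → ℝ), (∀ t, 0 < η t) → IsLeast (w '' F G η) (v G η) := by
    intro G η hη
    obtain ⟨q, hq, hqm⟩ := hmin G η hη
    have : IsLeast (w '' F G η) (w q) := ⟨⟨q, hq, rfl⟩, by rintro _ ⟨y, hy, rfl⟩; exact hqm hy⟩
    rw [hv]
    simp only
    rwa [this.csInf_eq]
  have hvconv : ∀ G, ConvexOn ℝ {η | ∀ t, 0 < η t} (v G) := by
    intro G
    have hcs : Convex ℝ {η : τ → ℝ | ∀ t, 0 < η t} := by
      intro η hη η' hη' a b ha hb hab t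
      exact (convex_Ioi (0 : ℝ)) (hη t) (hη' t) ha hb hab
    refine ⟨hcs, fun η hη η' hη' a b ha hb hab => ?_⟩
    obtain ⟨q, hq, hqe⟩ := (hleast G η hη).1
    obtain ⟨q', hq', hqe'⟩ := (hleast G η' hη').1
    rw [← hqe, ← hqe']
    refine ((hleast G _ (hcs hη hη' ha hb hab)).2 ⟨a • q + b • q', fun t ht => ?_, rfl⟩).trans
      (hw.convexOn.2 trivial trivial ha hb hab)
    refine ((hg t).2 trivial trivial ha hb hab).trans ?_
    exact add_le_add (smul_le_smul_of_nonneg_left (hq t ht) ha)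
      (smul_le_smul_of_nonneg_left (hq' t ht) hb)
  obtain ⟨η, hη, hdiff⟩ := exists_differentiableAt_of_convexOn v hvconv hδ
  have hη0 : ∀ t, 0 < η t := fun t => (hη t).1
  set m : Finset τ → ℝ := fun G => v G η with hm
  have hml : ∀ G, IsLeast (w '' F G η) (m G) := fun G => hleast G η hη0
  have hmono : ∀ {G H : Finset τ}, G ⊆ H → m G ≤ m H := by
    intro G H h
    obtain ⟨q, hq, hqe⟩ := (hml H).1
    rw [← hqe]
    exact (hml G).2 ⟨q, fun t ht => hq t (h ht), rfl⟩
  -- The support constraints: those whose removal lowers the minimum.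
  set I : Finset τ → Finset τ := fun G => G.filter fun j => m (G.erase j) < m G with hI
  have hIsub : ∀ G, I G ⊆ G := fun G => filter_subset _ _
  -- Relaxing one constraint outside `I G` is weaker than deleting it, so `v G` is constant in that
  -- direction. By differentiability at η, relaxing all of them together does not lower the minimum
  -- either; a large relaxation r makes them harmless at a minimizer for `I G`.
  have hmI : ∀ G, m (I G) = m G := by
    intro G
    refine le_antisymm (hmono (hIsub G)) ?_
    have hconst : ∀ j ∈ G \ I G, ∀ r : ℝ, 0 ≤ r → v G (η + r • Pi.single j 1) = v G η := by
      intro j hj r hr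
      have hpos : ∀ t, 0 < (η + r • Pi.single j (1 : ℝ) : τ → ℝ) t := by
        intro t
        have : 0 ≤ r * (Pi.single j (1 : ℝ) : τ → ℝ) t :=
          mul_nonneg hr (by
            rcases eq_or_ne t j with rfl | h
            · simp
            · simp [Pi.single_eq_of_ne h])
        have := hη0 t
        simp only [Pi.add_apply, Pi.smul_apply, smul_eq_mul]
        linarith
      have hl := hleast G _ hpos
      refine le_antisymm ?_ ?_
      · obtain ⟨q, hq, hqe⟩ := (hml G).1
        change _ ≤ m G
        rw [← hqe]
        refine hl.2 ⟨q, fun t ht => (hq t ht).trans ?_, rfl⟩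
        have : 0 ≤ r * (Pi.single j (1 : ℝ) : τ → ℝ) t :=
          mul_nonneg hr (by
            rcases eq_or_ne t j with rfl | h
            · simp
            · simp [Pi.single_eq_of_ne h])
        simp only [Pi.add_apply, Pi.smul_apply, smul_eq_mul]
        linarith
      · have hje : m G ≤ m (G.erase j) := by
          by_contra! h
          exact (Finset.mem_sdiff.1 hj).2 (mem_filter.2 ⟨(Finset.mem_sdiff.1 hj).1, h⟩)
        refine le_trans hje ?_
        obtain ⟨q, hq, hqe⟩ := hl.1
        rw [← hqe]
        refine (hml _).2 ⟨q, fun t ht => ?_, rfl⟩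
        have := hq t (mem_of_mem_erase ht)
        simpa [Pi.single_eq_of_ne (ne_of_mem_erase ht)] using this
    obtain ⟨q, hq, hqe⟩ := (hml (I G)).1
    obtain ⟨r, hr, hrq⟩ : ∃ r : ℝ, 0 < r ∧ ∀ t, g t q ≤ r := by
      refine ⟨∑ t, |g t q| + 1, by positivity, fun t => ?_⟩
      have := single_le_sum (f := fun t => |g t q|) (fun t _ => abs_nonneg _) (mem_univ t)
      have := le_abs_self (g t q)
      linarith
    have hle := (hvconv G).le_add_of_constant_directions hη0 (hdiff G) hconst hr
    have hu : ∀ t, (∑ j ∈ G \ I G, Pi.single j (1 : ℝ) : τ → ℝ) t =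
        if t ∈ G \ I G then 1 else 0 := by
      intro t
      rw [Finset.sum_apply]
      simp [Pi.single_apply]
    refine hle.trans ?_
    rw [← hqe]
    refine (hleast G _ fun t => ?_).2 ⟨q, fun t ht => ?_, rfl⟩
    · have := hη0 t
      rw [Pi.add_apply, Pi.smul_apply, hu]
      split_ifs <;> simp <;> linarith
    · rw [Pi.add_apply, Pi.smul_apply, hu]
      by_cases htI : t ∈ I G
      · have := hq t htI
        simpa [htI] using this
      · have := hrq t
        have := hη0 t
        rw [if_pos (Finset.mem_sdiff.2 ⟨ht, htI⟩), smul_eq_mul, mul_one]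
        linarith
  have hstab : ∀ G H, I G ⊆ H → m H = m G → I H = I G := by
    intro G H hGH hmH
    have hsub : I H ⊆ I G := by
      intro j hj
      by_contra hjG
      have h1 : I G ⊆ H.erase j := fun t ht =>
        mem_erase.2 ⟨fun h => hjG (h ▸ ht), hGH ht⟩
      have h2 := hmono h1
      rw [hmI, ← hmH] at h2
      exact absurd (mem_filter.1 hj).2 (not_lt.2 h2)
    refine Subset.antisymm hsub fun j hj => ?_
    by_contra hjH
    have h1 : I H ⊆ G.erase j := fun t ht =>
      mem_erase.2 ⟨fun h => hjH (h ▸ ht), hIsub G (hsub ht)⟩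
    have h2 := hmono h1
    rw [hmI, hmH] at h2
    exact absurd (mem_filter.1 hj).2 (not_lt.2 h2)
  refine ⟨η, m, I, hη, hml, ⟨hIsub, ?_, ?_, ?_⟩, hmI⟩
  · -- Helly's theorem for the relaxed constraints and the sublevel set of the objective
    intro G
    by_contra! hcard
    have hess : ∀ j ∈ I G, m ((I G).erase j) < m G := fun j hj =>
      (hmono (erase_subset_erase j (hIsub G))).trans_lt (mem_filter.1 hj).2
    set C : Option τ → Set V := fun o => o.elim {q | w q < m G} (fun t => {q | g t q ≤ η t})
      with hC
    have hCconv : ∀ o ∈ insertNone (I G), Convex ℝ (C o) := by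
      intro o _
      cases o with
      | none => simpa [hC] using hw.convexOn.convex_lt (m G)
      | some t => simpa [hC] using (hg t).convex_le (η t)
    obtain ⟨q, hq⟩ := Convex.helly_theorem' (𝕜 := ℝ) hCconv (by
      intro J hJ hJc
      -- The family has at least `finrank ℝ V + 2` members, so J omits one. If it is the sublevel
      -- set, x is a common point; if it is constraint j, a minimizer without j is one.
      have hne : ∃ o ∈ insertNone (I G), o ∉ J := by
        by_contra! hcon
        have := card_le_card (show insertNone (I G) ⊆ J from hcon)
        rw [card_insertNone] at this
        omega
      obtain ⟨o, ho, hoJ⟩ := hne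
      cases o with
      | none =>
        refine ⟨x, Set.mem_iInter₂.2 fun o ho' => ?_⟩
        cases o with
        | none => exact absurd ho' hoJ
        | some t => exact (hx t).trans (hη0 t).le
      | some j =>
        have hj : j ∈ I G := by simpa using ho
        obtain ⟨q, hq, hqe⟩ := (hml ((I G).erase j)).1
        refine ⟨q, Set.mem_iInter₂.2 fun o ho' => ?_⟩
        cases o with
        | none => exact hqe.trans_lt (hess j hj)
        | some t =>
          refine hq t (mem_erase.2 ⟨?_, ?_⟩)
          · rintro rfl
            exact hoJ ho'
          · simpa using hJ ho')
    rw [Set.mem_iInter₂] at hq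
    have h1 : w q < m G := hq none (by simp)
    have h2 : m (I G) ≤ w q := (hml _).2 ⟨q, fun t ht => hq (some t) (by simpa using ht), rfl⟩
    rw [hmI] at h2
    exact absurd h1 (not_lt.2 h2)
  · intro G H h1 h2
    refine hstab G H h1 (le_antisymm (hmono h2) ?_)
    rw [← hmI G]
    exact hmono h1
  · intro G G' h
    refine hstab G (G ∪ G') ((hIsub G).trans subset_union_left) ?_
    have hmm : m G' = m G := by rw [← hmI G', ← h, hmI]
    refine le_antisymm ?_ (hmono subset_union_left)
    -- By strict convexity the minimizers for G and G' both coincide with the one for the common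
    -- selection, which is therefore feasible for G ∪ G'.
    have huniq : ∀ {q q' : V}, q ∈ F (I G) η → q' ∈ F (I G) η → w q = m (I G) →
        w q' = m (I G) → q = q' := by
      intro q q' hq hq' e e'
      have hcF : Convex ℝ (F (I G) η) := by
        have : F (I G) η = ⋂ t ∈ I G, {q | g t q ≤ η t} := by ext q; simp [hF]
        rw [this]
        refine convex_iInter₂ fun t _ => ?_
        simpa using (hg t).convex_le (η t)
      refine (hw.subset (Set.subset_univ _) hcF).eq_of_isMinOn (s := F (I G) η) ?_ ?_ hq hq'
      · exact fun y hy => e.le.trans ((hml (I G)).2 ⟨y, hy, rfl⟩)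
      · exact fun y hy => e'.le.trans ((hml (I G)).2 ⟨y, hy, rfl⟩)
    obtain ⟨q, hq, hqe⟩ := (hml G).1
    obtain ⟨q', hq', hqe'⟩ := (hml G').1
    have hqq : q = q' := by
      refine huniq (fun t ht => hq t (hIsub G ht)) (fun t ht => hq' t (hIsub G' (h ▸ ht))) ?_ ?_
      · rw [hqe, hmI]
      · rw [hqe', hmI, hmm]
    rw [← hqe]
    refine (hml _).2 ⟨q, fun t ht => ?_, rfl⟩
    rcases mem_union.1 ht with ht | ht
    · exact hq t ht
    · exact hqq ▸ hq' t ht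

end Selection

/-! ### Interval selections for intersections of convex sets -/

section LocalSelection

open Finset Filter Topology Module

theorem convexOn_infDist {V : Type*} [NormedAddCommGroup V] [NormedSpace ℝ V] {s : Set V}
    (hs : Convex ℝ s) (hc : IsCompact s) (hne : s.Nonempty) :
    ConvexOn ℝ Set.univ fun q => Metric.infDist q s := by
  refine ⟨convex_univ, fun x _ y _ a b ha hb hab => ?_⟩
  obtain ⟨x', hx', hx⟩ := hc.exists_infDist_eq_dist hne x
  obtain ⟨y', hy', hy⟩ := hc.exists_infDist_eq_dist hne y
  simp only [hx, hy]
  refine (Metric.infDist_le_dist_of_mem (hs hx' hy' ha hb hab)).trans ?_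
  rw [dist_eq_norm, dist_eq_norm, dist_eq_norm]
  have : a • x + b • y - (a • x' + b • y') = a • (x - x') + b • (y - y') := by module
  rw [this]
  refine (norm_add_le _ _).trans ?_
  rw [norm_smul, norm_smul, Real.norm_of_nonneg ha, Real.norm_of_nonneg hb, smul_eq_mul,
    smul_eq_mul]

theorem Finite.exists_pos_le {κ : Type*} [Finite κ] (m : κ → ℝ) (hm : ∀ i, 0 < m i) :
    ∃ δ, 0 < δ ∧ ∀ i, δ ≤ m i := by
  cases isEmpty_or_nonempty κ with
  | inl h => exact ⟨1, one_pos, fun i => h.elim i⟩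
  | inr h =>
    obtain ⟨i, hi⟩ := Finite.exists_min m
    exact ⟨m i, hm i, hi⟩

/-- For convex sets `C t` with a common point and a convex set `B`, the families of the `C t` whose
intersection misses `B` split into intervals with lower end of at most `finrank ℝ V` members. -/
theorem exists_selection_of_convex {τ : Type*} [Fintype τ] [DecidableEq τ] {V : Type*}
    [NormedAddCommGroup V] [InnerProductSpace ℝ V] [FiniteDimensional ℝ V] (C : τ → Set V)
    (hC : ∀ t, Convex ℝ (C t)) (B : Set V) (hB : Convex ℝ B) (x : V) (hx : ∀ t, x ∈ C t) :
    ∃ I : Finset τ → Finset τ, IsIntervalSelection (finrank ℝ V) I ∧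
      ∀ G, (∃ q ∈ B, ∀ t ∈ I G, q ∈ C t) → ∃ q ∈ B, ∀ t ∈ G, q ∈ C t := by
  rcases B.eq_empty_or_nonempty with rfl | hBne
  · exact ⟨fun _ => ∅, isIntervalSelection_empty _, fun G ⟨q, hq, _⟩ => hq.elim⟩
  set N : Set (Finset τ) := {G | ∃ q ∈ B, ∀ t ∈ G, q ∈ C t} with hN
  have hN0 : ∅ ∈ N := by
    obtain ⟨q, hq⟩ := hBne
    exact ⟨q, hq, by simp⟩
  have hp : ∀ G, ∃ q, G ∈ N → q ∈ B ∧ ∀ t ∈ G, q ∈ C t := by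
    intro G
    by_cases h : G ∈ N
    · obtain ⟨q, hq⟩ := h
      exact ⟨q, fun _ => hq⟩
    · exact ⟨x, fun h' => absurd h' h⟩
  choose p hp using hp
  -- One witness for each G ∈ N is enough: polytopes spanned by the witnesses and x replace C t and
  -- B, keeping N and gaining compactness.
  set P : τ → Set V := fun t => convexHull ℝ (insert x (p '' {G | G ∈ N ∧ t ∈ G})) with hP
  set B₀ : Set V := convexHull ℝ (p '' N) with hB₀
  have hPc : ∀ t, IsCompact (P t) := fun t =>
    Set.Finite.isCompact_convexHull ℝ (((Set.toFinite _).image p).insert x)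
  have hPne : ∀ t, (P t).Nonempty := fun t => ⟨x, subset_convexHull ℝ _ (Set.mem_insert _ _)⟩
  have hPC : ∀ t, P t ⊆ C t := by
    intro t
    refine convexHull_min ?_ (hC t)
    rintro _ (rfl | ⟨G, ⟨hG, ht⟩, rfl⟩)
    · exact hx t
    · exact (hp G hG).2 t ht
  have hpP : ∀ G ∈ N, ∀ t ∈ G, p G ∈ P t := fun G hG t ht =>
    subset_convexHull ℝ _ (Set.mem_insert_of_mem _ ⟨G, ⟨hG, ht⟩, rfl⟩)
  have hB₀c : IsCompact B₀ := Set.Finite.isCompact_convexHull ℝ ((Set.toFinite _).image p)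
  have hpB : ∀ G ∈ N, p G ∈ B₀ := fun G hG => subset_convexHull ℝ _ ⟨G, hG, rfl⟩
  have hB₀ne : B₀.Nonempty := ⟨_, hpB _ hN0⟩
  have hB₀B : B₀ ⊆ B := by
    refine convexHull_min ?_ hB
    rintro _ ⟨G, hG, rfl⟩
    exact (hp G hG).1
  set g : τ → V → ℝ := fun t q => Metric.infDist q (P t) with hg
  have hgc : ∀ t, Continuous (g t) := fun t => Metric.continuous_infDist_pt _
  have hsep : ∀ G, ∃ r : ℝ, 0 < r ∧ (G ∉ N → ∀ b ∈ B₀, r ≤ ∑ t ∈ G, g t b) := by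
    intro G
    by_cases hG : G ∈ N
    · exact ⟨1, one_pos, fun h => absurd hG h⟩
    obtain ⟨b, hb, hmin⟩ := hB₀c.exists_isMinOn hB₀ne
      (f := fun b => ∑ t ∈ G, g t b) (continuous_finsetSum _ fun t _ => hgc t).continuousOn
    refine ⟨_, ?_, fun _ b' hb' => hmin hb'⟩
    refine lt_of_le_of_ne (sum_nonneg fun t _ => Metric.infDist_nonneg) fun h0 => hG ?_
    refine ⟨b, hB₀B hb, fun t ht => hPC t ?_⟩
    have := (sum_eq_zero_iff_of_nonneg (fun t _ => Metric.infDist_nonneg)).1 h0.symm t ht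
    exact ((hPc t).isClosed.mem_iff_infDist_zero (hPne t)).2 this
  choose r hr hrN using hsep
  obtain ⟨δ₀, hδ₀, hδr⟩ := Finite.exists_pos_le r hr
  set δ : ℝ := δ₀ / (2 * (Fintype.card τ + 1)) with hδ
  have hcpos : (0 : ℝ) < 2 * (Fintype.card τ + 1) := by positivity
  have hδpos : 0 < δ := div_pos hδ₀ hcpos
  have hδ2 : Fintype.card τ * (2 * δ) < δ₀ := by
    have : δ * (2 * (Fintype.card τ + 1)) = δ₀ := div_mul_cancel₀ _ hcpos.ne'
    nlinarith
  -- If q were within δ of B₀ too, its nearest point in B₀ would be within 2δ of each P t, t ∈ G;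
  -- the choice of δ keeps the sum of these distances below the gap δ₀.
  have hfar : ∀ G, G ∉ N → ∀ q, (∀ t ∈ G, g t q ≤ δ) → δ < Metric.infDist q B₀ := by
    intro G hG q hq
    by_contra! hle
    obtain ⟨b, hb, hqb⟩ := hB₀c.exists_infDist_eq_dist hB₀ne q
    have h1 : ∀ t ∈ G, g t b ≤ 2 * δ := by
      intro t ht
      have : g t b ≤ g t q + dist b q := Metric.infDist_le_infDist_add_dist
      have h2 := hq t ht
      rw [dist_comm, ← hqb] at this
      linarith
    have h2 := sum_le_card_nsmul _ _ _ h1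
    have h3 : (#G : ℝ) ≤ Fintype.card τ := by exact_mod_cast card_le_univ G
    have h4 := (hδr G).trans (hrN G hG b hb)
    rw [nsmul_eq_mul] at h2
    nlinarith
  obtain ⟨R, hR⟩ : ∃ R : ℝ, ∀ G, ‖p G‖ ^ 2 ≤ R := by
    obtain ⟨G, hG⟩ := Finite.exists_max fun G => ‖p G‖ ^ 2
    exact ⟨_, hG⟩
  have hR0 : 0 ≤ R := (sq_nonneg _).trans (hR ∅)
  set c : ℝ := δ / (R + 1) with hc
  have hcpos : 0 < c := div_pos hδpos (by linarith)
  have hcR : ∀ G, c * ‖p G‖ ^ 2 ≤ δ := by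
    intro G
    rw [hc, div_mul_eq_mul_div, div_le_iff₀ (by linarith)]
    have := hR G
    nlinarith
  -- The quadratic term makes w strictly convex and coercive, yet adds at most δ at the witnesses.
  -- So the level δ separates the minima for G ∈ N from the others.
  set w : V → ℝ := fun q => Metric.infDist q B₀ + c * ‖q‖ ^ 2 with hw
  have hw0 : ∀ q, Metric.infDist q B₀ ≤ w q := fun q => by
    simp only [hw]
    have : 0 ≤ c * ‖q‖ ^ 2 := by positivity
    linarith
  have hwsc : StrictConvexOn ℝ Set.univ w := by
    refine StrongConvexOn.strictConvexOn (m := 2 * c) ?_ (by linarith)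
    rw [strongConvexOn_iff_convex]
    have : (fun x => w x - 2 * c / (2 : ℝ) * ‖x‖ ^ 2) = fun q => Metric.infDist q B₀ := by
      ext q
      simp only [hw]
      ring
    rw [this]
    exact convexOn_infDist (convex_convexHull ℝ _) hB₀c hB₀ne
  have hwc : Continuous w := by
    have := Metric.continuous_infDist_pt B₀
    fun_prop
  have hwt : Tendsto w (cocompact V) atTop := by
    refine tendsto_atTop_mono (f := fun q => c * ‖q‖ ^ 2) (fun q => ?_) ?_
    · have : 0 ≤ Metric.infDist q B₀ := Metric.infDist_nonneg
      simp only [hw]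
      linarith
    · exact ((tendsto_pow_atTop two_ne_zero).comp
        (tendsto_norm_cocompact_atTop)).const_mul_atTop hcpos
  obtain ⟨η, m, I, hη, hm, hI, hmI⟩ := exists_selection_of_relaxation g
    (fun t => convexOn_infDist (convex_convexHull ℝ _) (hPc t) (hPne t)) hgc w hwsc hwc hwt x
    (fun t => (Metric.infDist_zero_of_mem (subset_convexHull ℝ _ (Set.mem_insert _ _))).le) hδpos
  have hmN : ∀ G, G ∈ N ↔ m G ≤ δ := by
    intro G
    constructor
    · intro hG
      refine ((hm G).2 ⟨p G, fun t ht => ?_, rfl⟩).trans ?_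
      · rw [hg]
        simp only
        rw [Metric.infDist_zero_of_mem (hpP G hG t ht)]
        exact (hη t).1.le
      · simp only [hw]
        rw [Metric.infDist_zero_of_mem (hpB G hG), zero_add]
        exact hcR G
    · intro hle
      by_contra hG
      obtain ⟨q, hq, hqe⟩ := (hm G).1
      have := hfar G hG q fun t ht => (hq t ht).trans (hη t).2.le
      have := hw0 q
      linarith
  refine ⟨I, hI, fun G hG => ?_⟩
  have h1 : I G ∈ N := hG
  rw [hmN, hmI, ← hmN] at h1
  exact h1

end LocalSelection

/-! ### Lexicographic minimization: convexity and measurability -/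

section Lexicographic

open Finset

theorem Pi.Lex.toLex_le_iff_zero {q : ℕ} (a b : Fin (q + 1) → ℝ) :
    toLex a ≤ toLex b ↔
      a 0 < b 0 ∨ a 0 = b 0 ∧ toLex (fun j : Fin q => a j.succ) ≤ toLex fun j => b j.succ := by
  have hlt : ∀ a b : Fin (q + 1) → ℝ, toLex a < toLex b ↔
      a 0 < b 0 ∨ a 0 = b 0 ∧ toLex (fun j : Fin q => a j.succ) < toLex fun j => b j.succ := by
    intro a b
    have := Fin.pi_lex_lt_cons_cons (α := fun _ : Fin (q + 1) => ℝ) (x₀ := a 0) (y₀ := b 0)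
      (x := Fin.tail a) (y := Fin.tail b) (fun x y => x < y)
    rw [Fin.cons_self_tail, Fin.cons_self_tail] at this
    exact this
  refine not_lt.symm.trans ((not_congr (hlt b a)).trans ?_)
  have := not_lt (a := toLex fun j : Fin q => b j.succ) (b := toLex fun j : Fin q => a j.succ)
  rcases lt_trichotomy (a 0) (b 0) with h | h | h
  · simp [h, h.ne', h.le]
  · simp only [h, lt_irrefl, false_or, true_and]
    exact this
  · simp [h.ne', h, h.le]

/-- A proper convex combination z of x ≤ y satisfies z ≤ y. Otherwise, before the first index where
z exceeds y, convexity and x ≤ y force x and y to agree; at that index convexity gives a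
contradiction. -/
theorem convex_toLex_lt {V : Type*} [AddCommGroup V] [Module ℝ V] {q : ℕ} {g : Fin q → V → ℝ}
    (hg : ∀ j, ConvexOn ℝ Set.univ (g j)) (a : Lex (Fin q → ℝ)) :
    Convex ℝ {x | toLex (fun j => g j x) < a} := by
  have key : ∀ x y : V, ∀ α β : ℝ, 0 < α → 0 < β → α + β = 1 →
      toLex (fun j => g j x) ≤ toLex (fun j => g j y) →
      toLex (fun j => g j (α • x + β • y)) ≤ toLex (fun j => g j y) := by
    intro x y α β hα hβ hab hle
    by_contra! hlt
    obtain ⟨i, hi, hlti⟩ := hlt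
    have hi : ∀ j < i, g j y = g j (α • x + β • y) := hi
    have hlti : g i y < g i (α • x + β • y) := hlti
    have hcv : ∀ j, g j (α • x + β • y) ≤ α * g j x + β * g j y := fun j =>
      (hg j).2 trivial trivial hα.le hβ.le hab
    have hβ' : β = 1 - α := by linarith
    subst hβ'
    have hge : ∀ j, (∀ l < j, g l x = g l y) → g j x ≤ g j y := by
      intro j hj
      by_contra! h
      exact absurd hle (not_le.2 ⟨j, fun l hl => (hj l hl).symm, h⟩)
    have heq : ∀ n : ℕ, ∀ j : Fin q, (j : ℕ) = n → j < i → g j x = g j y := by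
      intro n
      induction n using Nat.strong_induction_on with
      | _ n ih =>
        intro j hjn hj
        have h1 := hge j fun l hl => ih l (hjn ▸ hl) l rfl (hl.trans hj)
        have h2 := hcv j
        rw [← hi j hj] at h2
        nlinarith
    have h1 := hge i fun l hl => heq l l rfl hl
    have h2 := hcv i
    nlinarith
  intro x hx y hy α β hα hβ hab
  rcases hα.eq_or_lt with rfl | hα
  · have : β = 1 := by linarith
    simpa [this] using hy
  rcases hβ.eq_or_lt with rfl | hβ
  · have : α = 1 := by linarith
    simpa [this] using hx
  rcases le_total (toLex fun j => g j x) (toLex fun j => g j y) with h | h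
  · exact (key x y α β hα hβ hab h).trans_lt hy
  · have := key y x β α hβ hα (by linarith) h
    rw [add_comm] at this
    exact this.trans_lt hx

/-- Whether a random continuous inequality is solvable in a compact set is a measurable event. -/
theorem measurableSet_exists_mem_le_zero {Ω V : Type*} [MeasurableSpace Ω]
    [TopologicalSpace V] [SecondCountableTopology V] {h : Ω → V → ℝ} (hc : ∀ ω, Continuous (h ω))
    (hm : ∀ x, Measurable fun ω => h ω x) {C : Set V} (hC : IsCompact C) :
    MeasurableSet {ω | ∃ x ∈ C, h ω x ≤ 0} := by
  obtain ⟨D, hD, hDd⟩ := TopologicalSpace.exists_countable_dense C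
  -- By compactness the minimum over C is attained, so values below every 1/(n + 1) on a countable
  -- dense set suffice.
  have : {ω | ∃ x ∈ C, h ω x ≤ 0} = ⋂ n : ℕ, ⋃ x ∈ D, {ω | h ω x < 1 / ((n : ℝ) + 1)} := by
    ext ω
    simp only [Set.mem_ofPred_eq, Set.mem_iInter, Set.mem_iUnion, exists_prop]
    constructor
    · rintro ⟨x, hx, hle⟩ n
      have hopen : IsOpen {y : C | h ω y < 1 / ((n : ℝ) + 1)} :=
        isOpen_lt ((hc ω).comp continuous_subtype_val) continuous_const
      obtain ⟨y, hy, hyD⟩ := hDd.inter_open_nonempty _ hopen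
        ⟨⟨x, hx⟩, lt_of_le_of_lt hle Nat.one_div_pos_of_nat⟩
      exact ⟨y, hyD, hy⟩
    · intro H
      obtain ⟨y, -, -⟩ := H 0
      obtain ⟨x, hx, hmin⟩ := hC.exists_isMinOn ⟨y, y.2⟩ (hc ω).continuousOn
      refine ⟨x, hx, le_of_forall_pos_le_add fun e he => ?_⟩
      obtain ⟨n, hn⟩ := exists_nat_one_div_lt he
      obtain ⟨y, -, hy⟩ := H n
      have := hmin y.2
      simp only [Set.mem_ofPred_eq] at this
      linarith
  rw [this]
  refine MeasurableSet.iInter fun n => MeasurableSet.biUnion hD fun x _ => ?_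
  exact measurableSet_lt (hm x) measurable_const

/-- The lexicographic minimizers over a random compact set given by a continuous inequality are
again given by a random continuous inequality. -/
theorem exists_inequality_for_lex_minimizers {Ω V : Type*} [MeasurableSpace Ω]
    [TopologicalSpace V] [SecondCountableTopology V] [T2Space V] {C : Set V} (hC : IsCompact C)
    {q : ℕ} (g : Fin q → V → ℝ) (hg : ∀ j, Continuous (g j)) (h : Ω → V → ℝ)
    (hc : ∀ ω, Continuous (h ω)) (hm : ∀ x, Measurable fun ω => h ω x)
    (hne : ∀ ω, ∃ x ∈ C, h ω x ≤ 0) :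
    ∃ h' : Ω → V → ℝ, (∀ ω, Continuous (h' ω)) ∧ (∀ x, Measurable fun ω => h' ω x) ∧
      (∀ ω, ∃ x ∈ C, h' ω x ≤ 0) ∧ ∀ ω, ∀ x ∈ C, h' ω x ≤ 0 ↔
        h ω x ≤ 0 ∧ ∀ y ∈ C, h ω y ≤ 0 → toLex (fun j => g j x) ≤ toLex fun j => g j y := by
  induction q generalizing h with
  | zero =>
    refine ⟨h, hc, hm, hne, fun ω x _ => ⟨fun hx => ⟨hx, fun y _ _ => ?_⟩, And.left⟩⟩
    exact (congrArg toLex (Subsingleton.elim _ _)).le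
  | succ q ih =>
    -- The attained minimum of the first criterion is measurable. The inequality `max (h ω x) (g 0 x
    -- - v ω) ≤ 0` describes its minimizers, to which the induction hypothesis applies.
    set v : Ω → ℝ := fun ω => sInf (g 0 '' {x ∈ C | h ω x ≤ 0}) with hv
    have hleast : ∀ ω, IsLeast (g 0 '' {x ∈ C | h ω x ≤ 0}) (v ω) := by
      intro ω
      have hcomp : IsCompact {x ∈ C | h ω x ≤ 0} :=
        hC.inter_right (isClosed_le (hc ω) continuous_const)
      obtain ⟨x, hx⟩ := hne ω
      exact (hcomp.image (hg 0)).isLeast_sInf ⟨_, x, hx, rfl⟩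
    have hvm : Measurable v := by
      refine measurable_of_Iic fun a => ?_
      have : v ⁻¹' Set.Iic a = {ω | ∃ x ∈ C ∩ {x | g 0 x ≤ a}, h ω x ≤ 0} := by
        ext ω
        simp only [Set.mem_preimage, Set.mem_Iic, Set.mem_ofPred_eq]
        constructor
        · intro hle
          obtain ⟨x, ⟨hx, hx'⟩, hxe⟩ := (hleast ω).1
          exact ⟨x, ⟨hx, hxe.trans_le hle⟩, hx'⟩
        · rintro ⟨x, ⟨hx, hxa⟩, hx'⟩
          exact ((hleast ω).2 ⟨x, ⟨hx, hx'⟩, rfl⟩).trans hxa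
      rw [this]
      exact measurableSet_exists_mem_le_zero hc hm
        (hC.inter_right (isClosed_le (hg 0) continuous_const))
    obtain ⟨h', hc', hm', hne', hiff⟩ := ih (fun j => g j.succ) (fun j => hg j.succ)
      (fun ω x => max (h ω x) (g 0 x - v ω))
      (fun ω => (hc ω).max ((hg 0).sub continuous_const))
      (fun x => (hm x).max (measurable_const.sub hvm)) (by
        intro ω
        obtain ⟨x, ⟨hx, hx'⟩, hxe⟩ := (hleast ω).1
        exact ⟨x, hx, max_le hx' (by rw [hxe, sub_self])⟩)
    refine ⟨h', hc', hm', hne', fun ω x hx => ?_⟩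
    rw [hiff ω x hx]
    simp only [max_le_iff, sub_nonpos, Pi.Lex.toLex_le_iff_zero (q := q)]
    have hlb : ∀ y ∈ C, h ω y ≤ 0 → v ω ≤ g 0 y := fun y hy hy' => (hleast ω).2 ⟨y, ⟨hy, hy'⟩, rfl⟩
    constructor
    · rintro ⟨⟨h1, h2⟩, h3⟩
      refine ⟨h1, fun y hy hy' => ?_⟩
      rcases (h2.trans (hlb y hy hy')).lt_or_eq with hlt | heq
      · exact Or.inl hlt
      · exact Or.inr ⟨heq, h3 y hy ⟨hy', heq ▸ h2⟩⟩
    · rintro ⟨h1, h2⟩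
      obtain ⟨z, ⟨hz, hz'⟩, hze⟩ := (hleast ω).1
      have hxv : g 0 x ≤ v ω := by
        rcases h2 z hz hz' with hlt | ⟨heq, -⟩
        · exact hze ▸ hlt.le
        · exact (heq.trans hze).le
      refine ⟨⟨h1, hxv⟩, fun y hy hy' => ?_⟩
      rcases h2 y hy hy'.1 with hlt | ⟨-, hle⟩
      · exact absurd hlt (not_lt.2 (hy'.2.trans (hlb x hx h1)))
      · exact hle

end Lexicographic

/-! ### Interval selections for the optimal points -/

namespace MultiStageProgram

open Finset Module

variable {d N : ℕ} {Δ : Type*}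

/-- The cost and the tie-break functions, in the order in which they are minimized. -/
noncomputable def criterion (M : MultiStageProgram d N Δ) (j : Fin (M.p + 1))
    (x : EuclideanSpace ℝ (Fin d)) : ℝ :=
  ofLex (M.preference x) j

theorem convexOn_criterion (M : MultiStageProgram d N Δ) (h : M.TieBreakRule)
    (j : Fin (M.p + 1)) : ConvexOn ℝ Set.univ (M.criterion j) := by
  refine Fin.cases ?_ (fun j => ?_) j
  · exact (innerₛₗ ℝ M.c).convexOn convex_univ
  · exact h.1 j

theorem continuous_criterion (M : MultiStageProgram d N Δ) (h : M.TieBreakRule)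
    (j : Fin (M.p + 1)) : Continuous (M.criterion j) := by
  rw [← continuousOn_univ]
  exact (M.convexOn_criterion h j).continuousOn isOpen_univ

theorem exists_isOptimal (M : MultiStageProgram d N Δ) (h : M.TieBreakRule)
    {C : Set (EuclideanSpace ℝ (Fin d))} (hC : IsCompact C) (hne : C.Nonempty) :
    ∃ x, M.IsOptimal C x := by
  obtain ⟨h', -, -, h1, h2⟩ := exists_inequality_for_lex_minimizers (Ω := Unit) hC M.criterion
    (M.continuous_criterion h) (fun _ _ => 0) (fun _ => continuous_const)
    (fun _ => measurable_const) (fun _ => hne.imp fun x hx => ⟨hx, le_rfl⟩)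
  obtain ⟨x, hx, hx'⟩ := h1 ()
  exact ⟨x, hx, fun y hy => ((h2 () x hx).1 hx').2 y hy le_rfl⟩

/-- The optimal points of a convex program subject to finitely many constraints that are invariant
under a subspace `S` admit an interval selection of at most `d - dim S` constraints that changes
whenever a violated constraint is added. -/
theorem exists_selection_of_constraints (M : MultiStageProgram d N Δ) (h : M.TieBreakRule)
    {A : Set (EuclideanSpace ℝ (Fin d))} (hAX : A ⊆ M.X) (hAc : IsCompact A) (hA : Convex ℝ A)
    {τ : Type*} [Fintype τ] [DecidableEq τ] (C : τ → Set (EuclideanSpace ℝ (Fin d)))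
    (hC : ∀ t, Convex ℝ (C t)) (hCc : ∀ t, IsClosed (C t))
    (S : Submodule ℝ (EuclideanSpace ℝ (Fin d))) (hCS : ∀ t, ∀ x ∈ C t, ∀ ξ ∈ S, x + ξ ∈ C t)
    (hne : ∃ x ∈ A, ∀ t, x ∈ C t) (x : Finset τ → EuclideanSpace ℝ (Fin d))
    (hx : ∀ G, M.IsOptimal {y | y ∈ A ∧ ∀ t ∈ G, y ∈ C t} (x G)) :
    ∃ I : Finset τ → Finset τ, IsIntervalSelection (d - finrank ℝ S) I ∧
      ∀ G t, x G ∉ C t → I (insert t G) ≠ I G := by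
  classical
  obtain ⟨x₀, hx₀A, hx₀⟩ := hne
  have huniq : ∀ G z, M.IsOptimal {y | y ∈ A ∧ ∀ t ∈ G, y ∈ C t} z → z = x G := by
    intro G z hz
    have e : {y | y ∈ A ∧ ∀ t ∈ G, y ∈ C t} = A ∩ ⋂ t ∈ G, C t := by ext y; simp
    refine h.2 {y | y ∈ A ∧ ∀ t ∈ G, y ∈ C t} (fun y hy => hAX hy.1) ?_ ?_ z (x G) hz (hx G)
    · rw [e]
      exact hAc.inter_right (isClosed_biInter fun t _ => hCc t)
    · rw [e]
      exact hA.inter (convex_iInter₂ fun t _ => hC t)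
  -- The sets C t are invariant under S, so they can be tested after projection. Neither A nor the
  -- objective needs to be invariant: a point of the projected set of better points lifts to a
  -- better point.
  set π : EuclideanSpace ℝ (Fin d) →L[ℝ] Sᗮ := Sᗮ.orthogonalProjectionOnto with hπ
  have hker : ∀ y z, π y = π z → y - z ∈ S := by
    intro y z hyz
    have : y - z ∈ (π : EuclideanSpace ℝ (Fin d) →ₗ[ℝ] Sᗮ).ker := by
      rw [LinearMap.mem_ker]
      simp [hyz]
    rwa [Submodule.ker_orthogonalProjectionOnto, Submodule.orthogonal_orthogonal] at this
  have hCπ : ∀ t y, π y ∈ π '' C t → y ∈ C t := by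
    rintro t y ⟨z, hz, hzy⟩
    have := hCS t z hz _ (hker y z hzy.symm)
    rwa [add_sub_cancel] at this
  have hrank : finrank ℝ Sᗮ = d - finrank ℝ S := by
    have := S.finrank_add_finrank_orthogonal
    rw [finrank_euclideanSpace_fin] at this
    omega
  set better : EuclideanSpace ℝ (Fin d) → Set (EuclideanSpace ℝ (Fin d)) := fun z =>
    {y | y ∈ A ∧ M.preference y < M.preference z} with hbetter
  have hloc : ∀ z, ∃ I : Finset τ → Finset τ, IsIntervalSelection (d - finrank ℝ S) I ∧
      ∀ G : Finset τ, (∀ t ∈ G, z ∈ C t) → (∃ y ∈ better z, ∀ t ∈ I G, y ∈ C t) →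
        ∃ y ∈ better z, ∀ t ∈ G, y ∈ C t := by
    intro z
    have hconv : Convex ℝ (better z) := by
      have : better z = A ∩ {y | M.preference y < M.preference z} := rfl
      rw [this]
      exact hA.inter (convex_toLex_lt (M.convexOn_criterion h) _)
    obtain ⟨I, hI, hIp⟩ := exists_selection_of_convex
      -- Constraints violated by z become vacuous, so that π z is a common point; families satisfied
      -- by z are unaffected.
      (fun t => if z ∈ C t then π '' C t else Set.univ) (by
        intro t
        by_cases hz : z ∈ C t
        · simpa [hz] using (hC t).linear_image (π : EuclideanSpace ℝ (Fin d) →ₗ[ℝ] Sᗮ)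
        · simpa [hz] using convex_univ) (π '' better z)
      (hconv.linear_image (π : EuclideanSpace ℝ (Fin d) →ₗ[ℝ] Sᗮ)) (π z) (by
        intro t
        by_cases hz : z ∈ C t
        · simpa [hz] using ⟨z, hz, rfl⟩
        · simp [hz])
    rw [hrank] at hI
    refine ⟨I, hI, fun G hG hy => ?_⟩
    obtain ⟨y, hy, hyI⟩ := hy
    obtain ⟨_, ⟨y', hy', rfl⟩, hq⟩ := hIp G ⟨π y, ⟨y, hy, rfl⟩, fun t ht => by
      by_cases hz : z ∈ C t
      · simpa [hz] using ⟨y, hyI t ht, rfl⟩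
      · simp [hz]⟩
    refine ⟨y', hy', fun t ht => hCπ t y' ?_⟩
    have := hq t ht
    rwa [if_pos (hG t ht)] at this
  choose J hJ hJp using hloc
  have hxiff : ∀ z ∈ A, ∀ G : Finset τ, (∀ t ∈ G, z ∈ C t) →
      (x G = z ↔ ¬ ∃ y ∈ better z, ∀ t ∈ G, y ∈ C t) := by
    intro z hz G hG
    constructor
    · rintro rfl ⟨y, ⟨hyA, hy⟩, hyC⟩
      exact absurd hy (not_lt.2 ((hx G).2 y ⟨hyA, hyC⟩))
    · intro hno
      refine (huniq G z ⟨⟨hz, hG⟩, fun y hy => ?_⟩).symm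
      by_contra! hlt
      exact hno ⟨y, ⟨hy.1, hlt⟩, hy.2⟩
  -- Each G uses the local selection at its own optimum. Since `x (I G) = x G`, equal selections
  -- have equal optima and hence come from the same local selection.
  set I : Finset τ → Finset τ := fun G => J (x G) G with hI
  have hIsub : ∀ G, I G ⊆ G := fun G => (hJ (x G)).subset G
  have hxI : ∀ G, x (I G) = x G := by
    intro G
    rw [hxiff (x G) (hx G).1.1 (I G) fun t ht => (hx G).1.2 t (hIsub G ht)]
    intro hy
    have := hJp (x G) G (hx G).1.2 hy
    exact (hxiff (x G) (hx G).1.1 G (hx G).1.2).1 rfl this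
  have hxmono : ∀ G H, G ⊆ H → (∀ t ∈ H, x G ∈ C t) → x H = x G := by
    intro G H hGH hH
    rw [hxiff (x G) (hx G).1.1 H hH]
    rintro ⟨y, hy, hyC⟩
    exact (hxiff (x G) (hx G).1.1 G (hx G).1.2).1 rfl ⟨y, hy, fun t ht => hyC t (hGH ht)⟩
  have hxeq : ∀ G G', I G = I G' → x G = x G' := by
    intro G G' hGG'
    rw [← hxI G, hGG', hxI]
  refine ⟨I, ⟨hIsub, fun G => (hJ (x G)).card_le G, ?_, ?_⟩, ?_⟩
  · intro G H h1 h2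
    have hH : x H = x G := by
      rw [← hxI G]
      refine hxmono (I G) H h1 fun t ht => ?_
      rw [hxI]
      exact (hx G).1.2 t (h2 ht)
    simp only [hI, hH]
    exact (hJ (x G)).eq_of_between G H h1 h2
  · intro G G' hGG'
    have e := hxeq G G' hGG'
    have hU : x (G ∪ G') = x G := by
      refine hxmono G _ subset_union_left fun t ht => ?_
      rcases mem_union.1 ht with ht | ht
      · exact (hx G).1.2 t ht
      · exact e ▸ (hx G').1.2 t ht
    simp only [hI, hU]
    refine (hJ (x G)).union G G' ?_
    have : I G' = J (x G) G' := by simp only [hI, e]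
    rw [← this]
    exact hGG'
  · intro G t hGt hIt
    have := hxeq _ _ hIt
    exact hGt (this ▸ (hx (insert t G)).1.2 t (mem_insert_self _ _))

end MultiStageProgram

/-! ### Measurability of the solution map and independence of subsamples -/

namespace MultiStageProgram

variable {d N : ℕ} {Δ : Type*}

theorem isOptimal_solution (M : MultiStageProgram d N Δ) (h : M.TieBreakRule)
    (hX : IsCompact M.X) {K : Fin N → ℕ} {ω : ∀ i, Fin (K i) → Δ}
    (hcl : ∀ i δ, Continuous fun x => M.f i x δ) (hne : (M.feasibleSet ω).Nonempty) :
    M.IsOptimal (M.feasibleSet ω) (M.solution ω) := by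
  have hcomp : IsCompact (M.feasibleSet ω) := by
    have : M.feasibleSet ω = M.X ∩ ⋂ i, ⋂ κ, {x | M.f i x (ω i κ) ≤ 0} := by
      ext x; simp [feasibleSet]
    rw [this]
    exact hX.inter_right (isClosed_iInter fun i => isClosed_iInter fun κ =>
      isClosed_le (hcl i _) continuous_const)
  have hex := M.exists_isOptimal h hcomp hne
  rw [solution, dif_pos hex]
  exact hex.choose_spec

theorem isOptimal_unique (M : MultiStageProgram d N Δ) (h : M.TieBreakRule)
    {C : Set (EuclideanSpace ℝ (Fin d))} (hCX : C ⊆ M.X) (hC : IsCompact C) (hCc : Convex ℝ C)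
    {x y : EuclideanSpace ℝ (Fin d)} (hx : M.IsOptimal C x) (hy : M.IsOptimal C y) : x = y :=
  h.2 C hCX hC hCc x y hx hy

/-- The total constraint violation of the sampled program at a point. -/
noncomputable def totalViolation (M : MultiStageProgram d N Δ) {K : Fin N → ℕ}
    (ω : ∀ i, Fin (K i) → Δ) (x : EuclideanSpace ℝ (Fin d)) : ℝ :=
  ∑ i, ∑ κ, max (M.f i x (ω i κ)) 0

theorem mem_feasibleSet_iff (M : MultiStageProgram d N Δ) {K : Fin N → ℕ}
    (ω : ∀ i, Fin (K i) → Δ) (x : EuclideanSpace ℝ (Fin d)) :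
    x ∈ M.feasibleSet ω ↔ x ∈ M.X ∧ M.totalViolation ω x ≤ 0 := by
  refine and_congr_right fun _ => ?_
  have hnn : ∀ i, 0 ≤ ∑ κ, max (M.f i x (ω i κ)) 0 := fun i =>
    Finset.sum_nonneg fun κ _ => le_max_right _ _
  have hnn' : 0 ≤ M.totalViolation ω x := Finset.sum_nonneg fun i _ => hnn i
  rw [show M.totalViolation ω x ≤ 0 ↔ M.totalViolation ω x = 0 from
    ⟨fun h => le_antisymm h hnn', le_of_eq⟩, totalViolation, Finset.sum_eq_zero_iff_of_nonneg fun i _ => hnn i]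
  simp only [Finset.mem_univ, true_imp_iff]
  refine forall_congr' fun i => ?_
  rw [Finset.sum_eq_zero_iff_of_nonneg fun κ _ => le_max_right _ _]
  simp

theorem convex_feasibleSet (M : MultiStageProgram d N Δ) (hX : Convex ℝ M.X)
    (hf : ∀ i δ, ConvexOn ℝ Set.univ fun x => M.f i x δ) {K : Fin N → ℕ}
    (ω : ∀ i, Fin (K i) → Δ) : Convex ℝ (M.feasibleSet ω) := by
  have : M.feasibleSet ω = M.X ∩ ⋂ i, ⋂ κ, {x | M.f i x (ω i κ) ≤ 0} := by
    ext x; simp [feasibleSet]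
  rw [this]
  refine hX.inter (convex_iInter fun i => convex_iInter fun κ => ?_)
  simpa using (hf i (ω i κ)).convex_le 0

variable [MeasurableSpace Δ]

/-- The solution map agrees with a measurable map at all feasible multi-samples. -/
theorem exists_measurable_solution (M : MultiStageProgram d N Δ) (h : M.TieBreakRule)
    (hXne : M.X.Nonempty) (hXc : IsCompact M.X) (hX : Convex ℝ M.X)
    (hfm : ∀ i x, Measurable (M.f i x))
    (hf : ∀ i δ, ConvexOn ℝ Set.univ fun x => M.f i x δ) (K : Fin N → ℕ) :
    ∃ s : (∀ i, Fin (K i) → Δ) → EuclideanSpace ℝ (Fin d), Measurable s ∧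
      ∀ ω, (M.feasibleSet ω).Nonempty → M.solution ω = s ω := by
  classical
  have hcl : ∀ i δ, Continuous fun x => M.f i x δ := fun i δ => by
    rw [← continuousOn_univ]
    exact (hf i δ).continuousOn isOpen_univ
  have hvc : ∀ ω : ∀ i, Fin (K i) → Δ, Continuous (M.totalViolation ω) := fun ω =>
    continuous_finsetSum _ fun i _ => continuous_finsetSum _ fun κ _ =>
      (hcl i (ω i κ)).max continuous_const
  have hvm : ∀ x, Measurable fun ω : ∀ i, Fin (K i) → Δ => M.totalViolation ω x := fun x =>
    Finset.measurable_sum _ fun i _ => Finset.measurable_sum _ fun κ _ =>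
      ((hfm i x).comp ((measurable_pi_apply κ).comp (measurable_pi_apply i))).max measurable_const
  set Feas : Set (∀ i, Fin (K i) → Δ) := {ω | ∃ x ∈ M.X, M.totalViolation ω x ≤ 0}
  have hFeas : MeasurableSet Feas := measurableSet_exists_mem_le_zero hvc hvm hXc
  -- For infeasible multi-samples all of X is admitted, so that a minimizer always exists.
  set v : (∀ i, Fin (K i) → Δ) → EuclideanSpace ℝ (Fin d) → ℝ := fun ω x =>
    if ω ∈ Feas then M.totalViolation ω x else 0 with hv
  have hset : ∀ ω, {x ∈ M.X | v ω x ≤ 0} = if ω ∈ Feas then M.feasibleSet ω else M.X := by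
    intro ω
    by_cases hω : ω ∈ Feas
    · ext x
      simp [hv, hω, M.mem_feasibleSet_iff]
    · simp [hv, hω]
  have hvc' : ∀ ω, Continuous (v ω) := by
    intro ω
    by_cases hω : ω ∈ Feas
    · simpa [hv, hω] using hvc ω
    · simpa [hv, hω] using continuous_const
  obtain ⟨w, hwc, hwm, hwne, hw⟩ := exists_inequality_for_lex_minimizers hXc M.criterion
    (M.continuous_criterion h) v hvc'
    (fun x => Measurable.ite hFeas (hvm x) measurable_const) (by
      intro ω
      by_cases hω : ω ∈ Feas
      · obtain ⟨x, hx, hx'⟩ := hω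
        exact ⟨x, hx, by rw [hv]; simp only; rw [if_pos ⟨x, hx, hx'⟩]; exact hx'⟩
      · obtain ⟨x, hx⟩ := hXne
        exact ⟨x, hx, by simp [hv, hω]⟩)
  have hopt : ∀ ω, ∀ x ∈ M.X, w ω x ≤ 0 ↔ M.IsOptimal {x ∈ M.X | v ω x ≤ 0} x := by
    intro ω x hx
    rw [hw ω x hx]
    constructor
    · rintro ⟨h1, h2⟩
      exact ⟨⟨hx, h1⟩, fun y hy => h2 y hy.1 hy.2⟩
    · rintro ⟨h1, h2⟩
      exact ⟨h1.2, fun y hy hy' => h2 y ⟨hy, hy'⟩⟩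
  have huniq : ∀ ω x y, M.IsOptimal {x ∈ M.X | v ω x ≤ 0} x →
      M.IsOptimal {x ∈ M.X | v ω x ≤ 0} y → x = y := by
    intro ω x y hx hy
    refine M.isOptimal_unique h (fun x hx => hx.1)
      (hXc.inter_right (isClosed_le (hvc' ω) continuous_const)) ?_ hx hy
    change Convex ℝ {x ∈ M.X | v ω x ≤ 0}
    rw [hset]
    split_ifs
    · exact M.convex_feasibleSet hX hf ω
    · exact hX
  choose s hsX hs using hwne
  refine ⟨s, measurable_of_isClosed fun A hA => ?_, fun ω hω => ?_⟩
  -- By uniqueness of the minimizer, s ω ∈ A exactly when some minimizer lies in A.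
  · have : s ⁻¹' A = {ω | ∃ x ∈ M.X ∩ A, w ω x ≤ 0} := by
      ext ω
      constructor
      · exact fun hω => ⟨s ω, ⟨hsX ω, hω⟩, hs ω⟩
      · rintro ⟨x, ⟨hx, hxA⟩, hx'⟩
        have := huniq ω x (s ω) ((hopt ω x hx).1 hx') ((hopt ω _ (hsX ω)).1 (hs ω))
        exact Set.mem_preimage.2 (this ▸ hxA)
    rw [this]
    exact measurableSet_exists_mem_le_zero hwc hwm (hXc.inter_right hA)
  · have h1 := M.isOptimal_solution h hXc hcl hω
    have hωF : ω ∈ Feas := by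
      obtain ⟨x, hx⟩ := hω
      exact ⟨x, (M.mem_feasibleSet_iff ω x).1 hx⟩
    have h2 := (hopt ω _ (hsX ω)).1 (hs ω)
    refine huniq ω _ _ ?_ h2
    rw [hset, if_pos hωF]
    exact h1

/-- Independent samples indexed by `ι'`, reindexed along an injection. -/
theorem _root_.MeasureTheory.measurePreserving_pi_comp_injective {ι ι' : Type*} [Fintype ι]
    [Fintype ι'] (P : Measure Δ) [IsProbabilityMeasure P] {g : ι → ι'}
    (hg : Function.Injective g) :
    MeasurePreserving (fun (ω : ι' → Δ) (a : ι) => ω (g a)) (Measure.pi fun _ => P)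
      (Measure.pi fun _ => P) := by
  refine ⟨measurable_pi_lambda _ fun a => measurable_pi_apply _, ?_⟩
  have hind : ProbabilityTheory.iIndepFun (fun (i : ι') (ω : ι' → Δ) => ω i)
      (Measure.pi fun _ => P) :=
    ProbabilityTheory.iIndepFun_pi (X := fun _ x => x) fun _ => aemeasurable_id
  have := (ProbabilityTheory.iIndepFun_iff_map_fun_eq_pi_map
    fun a => (measurable_pi_apply (g a)).aemeasurable).1 (hind.precomp hg)
  rw [this]
  congr 1
  ext1 a
  exact (measurePreserving_eval (fun _ : ι' => P) (g a)).map_eq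

theorem measurePreserving_piCurry (P : Measure Δ) [IsProbabilityMeasure P] (K : Fin N → ℕ) :
    MeasurePreserving (MeasurableEquiv.piCurry fun (i : Fin N) (_ : Fin (K i)) => Δ)
      (Measure.pi fun _ => P) (sampleMeasure P K) := by
  refine ⟨MeasurableEquiv.measurable _, ?_⟩
  have := Measure.infinitePi_map_piCurry fun (i : Fin N) (_ : Fin (K i)) => P
  simp only [Measure.infinitePi_eq_pi] at this
  exact this

/-- Samples taken at distinct places of a larger multi-sample are independent with law `P`. -/
theorem measurePreserving_subsample (P : Measure Δ) [IsProbabilityMeasure P] {K L : Fin N → ℕ}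
    {m : ℕ} (i : Fin N) (e : ∀ j, Fin (K j) → Fin (L j)) (he : ∀ j, Function.Injective (e j))
    (e' : Fin m → Fin (L i)) (he' : Function.Injective e') (hd : ∀ κ l, e i κ ≠ e' l) :
    MeasurePreserving (fun ω : ∀ j, Fin (L j) → Δ => ((fun j κ => ω j (e j κ) : ∀ j, Fin (K j) → Δ),
      fun l => ω i (e' l))) (sampleMeasure P L)
      ((sampleMeasure P K).prod (Measure.pi fun _ : Fin m => P)) := by
  set g : (Σ j, Fin (K j)) ⊕ Fin m → Σ j, Fin (L j) :=
    Sum.elim (fun a => ⟨a.1, e a.1 a.2⟩) fun l => ⟨i, e' l⟩ with hg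
  have hginj : Function.Injective g := by
    refine Function.Injective.sumElim ?_ ?_ ?_
    · rintro ⟨j, κ⟩ ⟨j', κ'⟩ h
      obtain ⟨rfl, h2⟩ := Sigma.mk.inj_iff.1 h
      exact congrArg _ (he j (eq_of_heq h2))
    · intro l l' h
      exact he' (eq_of_heq (Sigma.mk.inj_iff.1 h).2)
    · rintro ⟨j, κ⟩ l h
      obtain ⟨h1, h2⟩ := Sigma.mk.inj_iff.1 h
      simp only at h1
      subst h1
      exact hd κ l (eq_of_heq h2)
  have h1 := (measurePreserving_piCurry P L).symm
  have h2 := measurePreserving_pi_comp_injective P hginj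
  have h3 := measurePreserving_sumPiEquivProdPi
    fun _ : (Σ j, Fin (K j)) ⊕ Fin m => P
  have h4 := (measurePreserving_piCurry P K).prod
    (MeasurePreserving.id (Measure.pi fun _ : Fin m => P))
  exact h4.comp (h3.comp (h2.comp h1))

end MultiStageProgram

/-! ### Hypergeometric limit and law of large numbers -/

section Asymptotics

open Finset Filter Topology ProbabilityTheory

theorem tendsto_choose_div_pow {a : ℕ → ℕ} {c : ℝ}
    (ha : Tendsto (fun m : ℕ => (a m : ℝ) / m) atTop (𝓝 c)) (j : ℕ) :
    Tendsto (fun m : ℕ => ((a m).choose j : ℝ) / (m : ℝ) ^ j) atTop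
      (𝓝 (c ^ j / (j.factorial : ℝ))) := by
  induction j with
  | zero => simp
  | succ j ih =>
    have h1 : Tendsto (fun m : ℕ => ((a m : ℝ) / m - j / m)) atTop (𝓝 (c - 0)) :=
      ha.sub (tendsto_const_div_atTop_nhds_zero_nat (j : ℝ))
    have h2 := (ih.mul h1).div_const ((j : ℝ) + 1)
    rw [sub_zero] at h2
    have e : c ^ j / (j.factorial : ℝ) * c / ((j : ℝ) + 1) =
        c ^ (j + 1) / ((j + 1).factorial : ℝ) := by
      rw [Nat.factorial_succ]
      push_cast
      field_simp
      ring
    rw [e] at h2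
    refine h2.congr' ?_
    filter_upwards [eventually_gt_atTop 0] with m hm
    have hm' : (m : ℝ) ≠ 0 := by positivity
    have h3 : ((a m).choose (j + 1) : ℝ) * (j + 1) = (a m).choose j * ((a m : ℝ) - j) := by
      rcases le_or_gt j (a m) with h | h
      · have := Nat.choose_succ_right_eq (a m) j
        have h4 : (((a m).choose (j + 1) * (j + 1) : ℕ) : ℝ) =
          (((a m).choose j * (a m - j) : ℕ) : ℝ) := by rw [this]
        push_cast [Nat.cast_sub h] at h4
        exact h4
      · rw [Nat.choose_eq_zero_of_lt h, Nat.choose_eq_zero_of_lt (by omega)]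
        simp
    have h5 : ((a m).choose (j + 1) : ℝ) = (a m).choose j * ((a m : ℝ) - j) / (j + 1) := by
      rw [eq_div_iff (by positivity), h3]
    rw [h5]
    field_simp
    ring

/-- The hypergeometric distribution converges to the binomial distribution. -/
theorem tendsto_hypergeometric {a b : ℕ → ℕ} {ε : ℝ} (n k : ℕ)
    (ha : Tendsto (fun m : ℕ => (a m : ℝ) / m) atTop (𝓝 ε))
    (hb : Tendsto (fun m : ℕ => (b m : ℝ) / m) atTop (𝓝 (1 - ε))) :
    Tendsto (fun m : ℕ => (∑ j ∈ range k, if j ≤ n then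
        ((a m).choose j : ℝ) * (b m).choose (n - j) else 0) / ((n + m).choose n : ℝ)) atTop
      (𝓝 (∑ j ∈ range k, (n.choose j : ℝ) * ε ^ j * (1 - ε) ^ (n - j))) := by
  have hn : Tendsto (fun m : ℕ => ((n + m : ℕ) : ℝ) / m) atTop (𝓝 1) := by
    have h1 : Tendsto (fun m : ℕ => (n : ℝ) / m + 1) atTop (𝓝 (0 + 1)) :=
      (tendsto_const_div_atTop_nhds_zero_nat (n : ℝ)).add_const 1
    rw [zero_add] at h1
    refine h1.congr' ?_
    filter_upwards [eventually_gt_atTop 0] with m hm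
    have hm' : (m : ℝ) ≠ 0 := by positivity
    push_cast
    field_simp
  have hN := tendsto_choose_div_pow hn n
  simp only [sum_div]
  refine tendsto_finsetSum _ fun j _ => ?_
  by_cases hj : j ≤ n
  · simp only [hj, if_true]
    have h := ((tendsto_choose_div_pow ha j).mul (tendsto_choose_div_pow hb (n - j))).div hN
      (by positivity)
    have e : ε ^ j / (j.factorial : ℝ) * ((1 - ε) ^ (n - j) / ((n - j).factorial : ℝ)) /
        (1 ^ n / (n.factorial : ℝ)) = (n.choose j : ℝ) * ε ^ j * (1 - ε) ^ (n - j) := by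
      rw [Nat.cast_choose ℝ hj, one_pow]
      field_simp
    rw [e] at h
    refine h.congr' ?_
    filter_upwards [eventually_gt_atTop 0] with m hm
    have hm' : (m : ℝ) ≠ 0 := by positivity
    have hc : ((n + m).choose n : ℝ) ≠ 0 := by
      exact_mod_cast (Nat.choose_pos (Nat.le_add_right n m)).ne'
    simp only [Pi.div_apply]
    have hp : (m : ℝ) ^ n = (m : ℝ) ^ j * (m : ℝ) ^ (n - j) := by
      rw [← pow_add, Nat.add_sub_cancel' hj]
    rw [hp]
    field_simp
  · simp only [hj, if_false, zero_div]
    rw [Nat.choose_eq_zero_of_lt (by omega)]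
    simp

/-- Split R at position a. The guard `j ≤ n` is needed since `n - j` is truncated. -/
theorem card_filter_initial_le {M : ℕ} (n k a : ℕ) (ha : a ≤ M) :
    #((powersetCard n (univ : Finset (Fin M))).filter fun R =>
        #(R.filter fun t : Fin M => t.val < a) < k) ≤
      ∑ j ∈ range k, if j ≤ n then a.choose j * (M - a).choose (n - j) else 0 := by
  classical
  set F : Finset (Fin M) := univ.filter fun t => t.val < a with hF
  have hFc : #F = a := by
    rw [hF, Fin.card_filter_val_lt]
    omega
  have hsub : ((powersetCard n (univ : Finset (Fin M))).filter fun R =>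
      #(R.filter fun t : Fin M => t.val < a) < k) ⊆
      (range k).biUnion fun j => if j ≤ n then
        ((powersetCard j F) ×ˢ (powersetCard (n - j) Fᶜ)).image fun p => p.1 ∪ p.2 else ∅ := by
    intro R hR
    rw [mem_filter, mem_powersetCard] at hR
    set R₁ := R.filter fun t : Fin M => t.val < a
    set R₂ := R.filter fun t : Fin M => ¬ t.val < a
    have hc : #R₁ + #R₂ = n := by
      rw [← hR.1.2]
      exact card_filter_add_card_filter_not _
    refine mem_biUnion.2 ⟨#R₁, mem_range.2 hR.2, ?_⟩
    rw [if_pos (by omega)]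
    refine mem_image.2 ⟨(R₁, R₂), mem_product.2 ⟨mem_powersetCard.2 ⟨?_, rfl⟩,
      mem_powersetCard.2 ⟨?_, by dsimp only; omega⟩⟩, filter_union_filter_not_eq _ _⟩
    · intro t ht
      exact mem_filter.2 ⟨mem_univ _, (mem_filter.1 ht).2⟩
    · intro t ht
      rw [mem_compl, hF, mem_filter]
      exact fun h => (mem_filter.1 ht).2 h.2
  refine (card_le_card hsub).trans (card_biUnion_le.trans (sum_le_sum fun j _ => ?_))
  split_ifs
  · refine card_image_le.trans ?_
    rw [card_product, card_powersetCard, card_powersetCard, card_compl, hFc, Fintype.card_fin]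
  · simp

/-- Weak law of large numbers for the number of samples that fall into a set. -/
theorem tendsto_measure_card_ge {Δ : Type*} [MeasurableSpace Δ] (P : Measure Δ)
    [IsProbabilityMeasure P] {A : Set Δ} [DecidablePred (· ∈ A)] (hA : MeasurableSet A) {ε : ℝ}
    (hε : ε < P.real A) :
    Tendsto (fun m : ℕ => (Measure.pi fun _ : Fin m => P)
      {z | ⌈ε * m⌉₊ ≤ #{l | z l ∈ A}}) atTop (𝓝 1) := by
  set p := P.real A with hp
  set X : Δ → ℝ := A.indicator 1 with hX
  have hXm : Measurable X := measurable_one.indicator hA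
  have hX01 : ∀ δ, X δ ∈ Set.Icc (0 : ℝ) 1 := fun δ => by
    by_cases h : δ ∈ A <;> simp [hX, h]
  have hXL : MemLp X 2 P := memLp_of_bounded (Filter.Eventually.of_forall hX01)
    hXm.aestronglyMeasurable 2
  have hEX : ∫ δ, X δ ∂P = p := by rw [hX, integral_indicator_one hA]
  -- Chebyshev's inequality; an indicator has variance at most 1/4.
  have hbound : ∀ m : ℕ, 0 < m →
      (Measure.pi fun _ : Fin m => P) {z : Fin m → Δ | ⌈ε * m⌉₊ ≤ #{l | z l ∈ A}}ᶜ ≤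
        ENNReal.ofReal (1 / (4 * (p - ε) ^ 2) / m) := by
    intro m hm
    have hm' : (0 : ℝ) < m := by exact_mod_cast hm
    set μ := Measure.pi fun _ : Fin m => P
    set Y : (Fin m → Δ) → ℝ := ∑ l, fun z => X (z l) with hY
    have hXl : ∀ l : Fin m, MemLp (fun z : Fin m → Δ => X (z l)) 2 μ := fun l =>
      memLp_of_bounded (Filter.Eventually.of_forall fun z : Fin m → Δ => hX01 (z l))
        (hXm.comp (measurable_pi_apply l)).aestronglyMeasurable 2
    have hYL : MemLp Y 2 μ := memLp_finsetSum' _ fun l _ => hXl l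
    have hEY : ∫ z, Y z ∂μ = m * p := by
      simp only [hY, Finset.sum_apply]
      rw [integral_finsetSum _ fun l _ => (hXl l).integrable one_le_two]
      have : ∀ l : Fin m, ∫ z, X (z l) ∂μ = p := fun l => by
        rw [← hEX]
        exact integral_comp_eval (μ := fun _ : Fin m => P) hXm.aestronglyMeasurable
      simp [this]
    have hVar : Var[Y; μ] ≤ m / 4 := by
      rw [hY, variance_sum_pi fun _ => hXL]
      have h1 : Var[X; P] ≤ 1 / 4 := by
        have := variance_le_sq_of_bounded (Filter.Eventually.of_forall hX01) hXm.aemeasurable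
          (μ := P)
        norm_num at this ⊢
        exact this
      simp only [sum_const, card_univ, Fintype.card_fin, nsmul_eq_mul]
      nlinarith
    have hYc : ∀ z : Fin m → Δ, Y z = #{l | z l ∈ A} := by
      intro z
      simp only [hY, Finset.sum_apply, hX, Set.indicator_apply, Pi.one_apply]
      rw [Finset.sum_boole]
    have hgap : 0 < m * (p - ε) := mul_pos hm' (by linarith)
    calc μ {z : Fin m → Δ | ⌈ε * m⌉₊ ≤ #{l | z l ∈ A}}ᶜ
        ≤ μ {z | m * (p - ε) ≤ |Y z - ∫ z, Y z ∂μ|} := by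
          refine measure_mono fun z hz => ?_
          change m * (p - ε) ≤ |Y z - ∫ z, Y z ∂μ|
          have hz : #{l | z l ∈ A} < ⌈ε * m⌉₊ := not_le.1 hz
          have h1 := Nat.lt_ceil.1 hz
          rw [← hYc] at h1
          rw [hEY, abs_sub_comm]
          refine le_trans ?_ (le_abs_self _)
          linarith
      _ ≤ ENNReal.ofReal (Var[Y; μ] / (m * (p - ε)) ^ 2) := meas_ge_le_variance_div_sq hYL hgap
      _ ≤ _ := by
          refine ENNReal.ofReal_le_ofReal ?_
          refine (div_le_div_of_nonneg_right hVar (by positivity)).trans (le_of_eq ?_)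
          have : p - ε ≠ 0 := by linarith
          field_simp
  have hmeas : ∀ m : ℕ, MeasurableSet {z : Fin m → Δ | ⌈ε * m⌉₊ ≤ #{l | z l ∈ A}} := by
    intro m
    have : Measurable fun z : Fin m → Δ => #{l | z l ∈ A} := by
      simp only [card_filter]
      refine Finset.measurable_sum _ fun l _ => Measurable.ite ?_ measurable_const measurable_const
      exact measurable_pi_apply l hA
    exact measurableSet_le measurable_const this
  have hlim : Tendsto (fun m : ℕ => 1 - ENNReal.ofReal (1 / (4 * (p - ε) ^ 2) / m)) atTop
      (𝓝 (1 - 0)) := by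
    refine ENNReal.Tendsto.sub tendsto_const_nhds ?_ (Or.inl ENNReal.one_ne_top)
    rw [← ENNReal.ofReal_zero]
    exact ENNReal.tendsto_ofReal (tendsto_const_div_atTop_nhds_zero_nat _)
  rw [tsub_zero] at hlim
  refine tendsto_of_tendsto_of_tendsto_of_le_of_le' hlim tendsto_const_nhds ?_
    (Filter.Eventually.of_forall fun m => prob_le_one)
  filter_upwards [eventually_gt_atTop 0] with m hm
  have h1 := hbound m hm
  rw [prob_compl_eq_one_sub (hmeas m)] at h1
  exact tsub_le_iff_tsub_le.1 h1

end Asymptotics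

/-! ### The finite-sample bound and its limit -/

namespace MultiStageProgram

open Finset Filter Topology Module

variable {d N : ℕ} {Δ : Type*}

/-- Among the choices of `n` out of `n + m` samples of stage `i`, few lead to a solution that is
violated by at least `s` of the other samples. -/
theorem card_filter_violated_le (M : MultiStageProgram d N Δ) (h : M.TieBreakRule)
    (hXc : IsCompact M.X) (hX : Convex ℝ M.X)
    (hf : ∀ i δ, ConvexOn ℝ Set.univ fun x => M.f i x δ) (i : Fin N)
    (S : Submodule ℝ (EuclideanSpace ℝ (Fin d)))
    (hS : ∀ δ x, ∀ ξ ∈ S, M.f i (x + ξ) δ = M.f i x δ) {K L : Fin N → ℕ} {m : ℕ}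
    (ω : ∀ j, Fin (L j) → Δ) (hω : (M.feasibleSet ω).Nonempty)
    (u : Fin (K i + m) → Fin (L i)) (e : Finset (Fin (K i + m)) → ∀ j, Fin (K j) → Fin (L j))
    (he : ∀ R, #R = K i → Set.range (e R i) = u '' R)
    (hej : ∀ R R', ∀ j ≠ i, e R j = e R' j)
    (e' : Finset (Fin (K i + m)) → Fin m → Fin (K i + m))
    (he' : ∀ R, #R = K i → Function.Injective (e' R)) (s : ℕ) (hs : 1 ≤ s) :
    #{R ∈ powersetCard (K i) (univ : Finset (Fin (K i + m))) |
        s ≤ #{l | 0 < M.f i (M.solution fun j κ => ω j (e R j κ)) (ω i (u (e' R l)))}} ≤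
      #((powersetCard (K i) (univ : Finset (Fin (K i + m)))).filter fun R =>
        #(R.filter fun t : Fin (K i + m) => t.val < s + (d - finrank ℝ S) - 1) <
          d - finrank ℝ S) := by
  classical
  have hcl : ∀ i δ, Continuous fun x => M.f i x δ := fun i δ => by
    rw [← continuousOn_univ]
    exact (hf i δ).continuousOn isOpen_univ
  -- The constraints of the other stages do not depend on R and are absorbed into A; `e ∅` stands
  -- for any choice.
  set A : Set (EuclideanSpace ℝ (Fin d)) :=
    {x | x ∈ M.X ∧ ∀ j ≠ i, ∀ κ, M.f j x (ω j (e ∅ j κ)) ≤ 0} with hA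
  have hAeq : A = M.X ∩ ⋂ j, ⋂ (_ : j ≠ i), ⋂ κ, {x | M.f j x (ω j (e ∅ j κ)) ≤ 0} := by
    ext x; simp [hA]
  have hAc : IsCompact A := by
    rw [hAeq]
    exact hXc.inter_right (isClosed_iInter fun j => isClosed_iInter fun _ =>
      isClosed_iInter fun κ => isClosed_le (hcl j _) continuous_const)
  have hAconv : Convex ℝ A := by
    rw [hAeq]
    refine hX.inter (convex_iInter fun j => convex_iInter fun _ => convex_iInter fun κ => ?_)
    simpa using (hf j (ω j (e ∅ j κ))).convex_le 0
  set C : Fin (K i + m) → Set (EuclideanSpace ℝ (Fin d)) := fun t =>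
    {x | M.f i x (ω i (u t)) ≤ 0} with hC
  have hCconv : ∀ t, Convex ℝ (C t) := fun t => by
    simpa using (hf i (ω i (u t))).convex_le 0
  have hCc : ∀ t, IsClosed (C t) := fun t => isClosed_le (hcl i _) continuous_const
  obtain ⟨x₀, hx₀X, hx₀⟩ := hω
  have hFc : ∀ G : Finset (Fin (K i + m)), {y | y ∈ A ∧ ∀ t ∈ G, y ∈ C t} = A ∩ ⋂ t ∈ G, C t :=
    fun G => by ext y; simp
  have hFcomp : ∀ G : Finset (Fin (K i + m)), IsCompact {y | y ∈ A ∧ ∀ t ∈ G, y ∈ C t} := by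
    intro G
    rw [hFc]
    exact hAc.inter_right (isClosed_biInter fun t _ => hCc t)
  have hFconv : ∀ G : Finset (Fin (K i + m)), Convex ℝ {y | y ∈ A ∧ ∀ t ∈ G, y ∈ C t} := by
    intro G
    rw [hFc]
    exact hAconv.inter (convex_iInter₂ fun t _ => hCconv t)
  have hx₀A : x₀ ∈ A := ⟨hx₀X, fun j _ κ => hx₀ j _⟩
  have hex : ∀ G : Finset (Fin (K i + m)), ∃ x, M.IsOptimal {y | y ∈ A ∧ ∀ t ∈ G, y ∈ C t} x :=
    fun G => M.exists_isOptimal h (hFcomp G) ⟨x₀, hx₀A, fun t _ => hx₀ i _⟩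
  choose x hx using hex
  obtain ⟨I, hI, hIv⟩ := M.exists_selection_of_constraints h (fun y hy => hy.1) hAc hAconv C hCconv
    hCc S (fun t y hy ξ hξ => by
      change M.f i (y + ξ) _ ≤ 0
      rw [hS _ _ _ hξ]
      exact hy) ⟨x₀, hx₀A, fun t => hx₀ i _⟩ x hx
  have hsol : ∀ R, #R = K i → M.solution (fun j κ => ω j (e R j κ)) = x R := by
    intro R hR
    have hfeas : M.feasibleSet (fun j κ => ω j (e R j κ)) =
        {y | y ∈ A ∧ ∀ t ∈ R, y ∈ C t} := by
      ext y
      constructor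
      · rintro ⟨hyX, hy⟩
        refine ⟨⟨hyX, fun j hj κ => ?_⟩, fun t ht => ?_⟩
        · have := hy j κ
          simpa only [hej R ∅ j hj] using this
        · obtain ⟨κ, hκ⟩ : u t ∈ Set.range (e R i) := he R hR ▸ ⟨t, ht, rfl⟩
          have := hy i κ
          simp only [hκ] at this
          exact this
      · rintro ⟨⟨hyX, hy⟩, hyR⟩
        refine ⟨hyX, fun j κ => ?_⟩
        by_cases hj : j = i
        · subst hj
          obtain ⟨t, ht, hte⟩ : e R j κ ∈ u '' R := he R hR ▸ ⟨κ, rfl⟩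
          have := hyR t ht
          simp only [hC, hte] at this
          exact this
        · simp only [hej R ∅ j hj]
          exact hy j hj κ
    have h1 := M.isOptimal_solution h hXc (ω := fun j κ => ω j (e R j κ)) hcl (by
      rw [hfeas]
      exact ⟨x₀, hx₀A, fun t _ => hx₀ i _⟩)
    rw [hfeas] at h1
    exact M.isOptimal_unique h (fun y hy => hy.1.1) (hFcomp R) (hFconv R) h1 (hx R)
  refine le_trans (card_le_card fun R hR => ?_)
    (hI.card_filter_viol_le (fun G => univ.filter fun t => x G ∉ C t)
      (fun G t ht => hIv G t (mem_filter.1 ht).2) (K i) s hs)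
  rw [mem_filter] at hR ⊢
  refine ⟨hR.1, hR.2.trans ?_⟩
  have hRc := (mem_powersetCard.1 hR.1).2
  rw [hsol R hRc]
  refine card_le_card_of_injOn (e' R) (fun l hl => ?_) (he' R hRc).injOn
  have hl := (mem_filter.1 hl).2
  exact mem_filter.2 ⟨mem_univ _, not_le.2 hl⟩

variable [MeasurableSpace Δ]

theorem measurable_constraint_comp (M : MultiStageProgram d N Δ)
    (hfm : ∀ i x, Measurable (M.f i x))
    (hf : ∀ i δ, ConvexOn ℝ Set.univ fun x => M.f i x δ) (i : Fin N) {Ω : Type*}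
    [MeasurableSpace Ω] {s : Ω → EuclideanSpace ℝ (Fin d)} (hs : Measurable s) {w : Ω → Δ}
    (hw : Measurable w) : Measurable fun ω => M.f i (s ω) (w ω) := by
  have : Measurable (Function.uncurry (M.f i)) :=
    measurable_uncurry_of_continuous_of_measurable (fun δ => by
      rw [← continuousOn_univ]
      exact (hf i δ).continuousOn isOpen_univ) (hfm i)
  exact this.comp (hs.prodMk hw)

/-- The expected finite-sample bound: draw `m` further samples of stage `i`. -/
theorem prod_measure_violated_le (P : Measure Δ) [IsProbabilityMeasure P]
    (M : MultiStageProgram d N Δ) (h : M.TieBreakRule)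
    (hXc : IsCompact M.X) (hX : Convex ℝ M.X) (hfm : ∀ i x, Measurable (M.f i x))
    (hf : ∀ i δ, ConvexOn ℝ Set.univ fun x => M.f i x δ)
    (h_feasible : ∀ K : Fin N → ℕ, ∀ᵐ ω ∂sampleMeasure P K, (M.feasibleSet ω).Nonempty)
    (i : Fin N) (S : Submodule ℝ (EuclideanSpace ℝ (Fin d)))
    (hS : ∀ δ x, ∀ ξ ∈ S, M.f i (x + ξ) δ = M.f i x δ) {K : Fin N → ℕ}
    {x : (∀ j, Fin (K j) → Δ) → EuclideanSpace ℝ (Fin d)} (hxm : Measurable x)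
    (hx : ∀ ω, (M.feasibleSet ω).Nonempty → M.solution ω = x ω) (m s : ℕ) (hs : 1 ≤ s) :
    ((K i + m).choose (K i) : ENNReal) *
      ((sampleMeasure P K).prod (Measure.pi fun _ : Fin m => P))
        {p | s ≤ #{l | 0 < M.f i (x p.1) (p.2 l)}} ≤
      #((powersetCard (K i) (univ : Finset (Fin (K i + m)))).filter fun R =>
        #(R.filter fun t : Fin (K i + m) => t.val < s + (d - finrank ℝ S) - 1) <
          d - finrank ℝ S) := by
  classical
  set T := #((powersetCard (K i) (univ : Finset (Fin (K i + m)))).filter fun R =>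
        #(R.filter fun t : Fin (K i + m) => t.val < s + (d - finrank ℝ S) - 1) <
          d - finrank ℝ S)
  set Q := (sampleMeasure P K).prod (Measure.pi fun _ : Fin m => P)
  set B : Set ((∀ j, Fin (K j) → Δ) × (Fin m → Δ)) :=
    {p | s ≤ #{l | 0 < M.f i (x p.1) (p.2 l)}} with hB
  have hBm : MeasurableSet B := by
    have : Measurable fun p : (∀ j, Fin (K j) → Δ) × (Fin m → Δ) =>
        #{l | 0 < M.f i (x p.1) (p.2 l)} := by
      simp only [card_filter]
      refine Finset.measurable_sum _ fun l _ => Measurable.ite ?_ measurable_const measurable_const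
      exact measurableSet_lt measurable_const (M.measurable_constraint_comp hfm hf i
        (hxm.comp measurable_fst) ((measurable_pi_apply l).comp measurable_snd))
    exact measurableSet_le measurable_const this
  -- a multi-sample that is large enough for all the subsamples considered
  set L : Fin N → ℕ := fun j => K j + m
  set pick : Finset (Fin (K i + m)) → Fin (K i) → Fin (K i + m) := fun R κ =>
    if hR : #R = K i then R.orderEmbOfFin hR κ else Fin.castAdd m κ with hpick
  have hpick_inj : ∀ R, Function.Injective (pick R) := by
    intro R
    by_cases hR : #R = K i
    · simpa [hpick, hR] using (R.orderEmbOfFin hR).injective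
    · simpa [hpick, hR] using Fin.castAdd_injective (K i) m
  set e : Finset (Fin (K i + m)) → ∀ j, Fin (K j) → Fin (L j) := fun R =>
    Function.update (fun j κ => Fin.castAdd m κ) i (pick R) with he
  have hei : ∀ R, e R i = pick R := fun R => Function.update_self _ _ _
  have hej : ∀ R, ∀ j ≠ i, e R j = Fin.castAdd m := fun R j hj => Function.update_of_ne hj _ _
  have heinj : ∀ R j, Function.Injective (e R j) := by
    intro R j
    by_cases hj : j = i
    · subst hj
      rw [hei]
      exact hpick_inj R
    · rw [hej R j hj]
      exact Fin.castAdd_injective _ _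
  have hcompl : ∀ R : Finset (Fin (K i + m)), #R = K i → #Rᶜ = m := by
    intro R hR
    rw [card_compl, Fintype.card_fin, hR]
    omega
  set rest : Finset (Fin (K i + m)) → Fin m → Fin (K i + m) := fun R l =>
    if hR : #R = K i then Rᶜ.orderEmbOfFin (hcompl R hR) l else Fin.natAdd (K i) l with hrest
  have hrest_inj : ∀ R, #R = K i → Function.Injective (rest R) := by
    intro R hR
    simpa [hrest, hR] using (Rᶜ.orderEmbOfFin (hcompl R hR)).injective
  have hrange : ∀ R, #R = K i → Set.range (e R i) = id '' (R : Set (Fin (K i + m))) := by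
    intro R hR
    rw [hei, Set.image_id]
    have : pick R = R.orderEmbOfFin hR := by
      ext κ
      simp [hpick, hR]
    rw [this]
    exact range_orderEmbOfFin R hR
  have hdisj : ∀ R, #R = K i → ∀ κ l, e R i κ ≠ rest R l := by
    intro R hR κ l heq
    have h1 : e R i κ ∈ R := by
      have : e R i κ ∈ Set.range (e R i) := ⟨κ, rfl⟩
      rw [hrange R hR, Set.image_id] at this
      exact this
    have h2 : rest R l ∈ Rᶜ := by
      have : rest R l = Rᶜ.orderEmbOfFin (hcompl R hR) l := by simp [hrest, hR]
      rw [this]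
      exact orderEmbOfFin_mem _ _ _
    exact (mem_compl.1 h2) (heq ▸ h1)
  set Ψ : Finset (Fin (K i + m)) → (∀ j, Fin (L j) → Δ) →
      (∀ j, Fin (K j) → Δ) × (Fin m → Δ) := fun R ω =>
    (fun j κ => ω j (e R j κ), fun l => ω i (rest R l)) with hΨ
  have hΨ_mp : ∀ R, #R = K i → MeasurePreserving (Ψ R) (sampleMeasure P L) Q := fun R hR =>
    measurePreserving_subsample P i (e R) (heinj R) (rest R) (hrest_inj R hR) (hdisj R hR)
  have hae : ∀ᵐ ω ∂sampleMeasure P L,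
      ∑ R ∈ powersetCard (K i) (univ : Finset (Fin (K i + m))),
        (Ψ R ⁻¹' B).indicator (1 : (∀ j, Fin (L j) → Δ) → ENNReal) ω ≤ T := by
    -- Feasibility for the enlarged sizes L supplies a point satisfying all constraints at once, as
    -- the counting bound requires.
    filter_upwards [h_feasible L] with ω hω
    have hcount := M.card_filter_violated_le h hXc hX hf i S hS ω hω id e hrange
      (fun R R' j hj => by rw [hej R j hj, hej R' j hj]) rest hrest_inj s hs
    have hsub : ∀ R, (M.feasibleSet fun j κ => ω j (e R j κ)).Nonempty := fun R =>
      hω.mono fun y hy => ⟨hy.1, fun j κ => hy.2 j _⟩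
    simp only [Set.indicator_apply, Pi.one_apply]
    rw [Finset.sum_boole]
    refine Nat.cast_le.2 (le_trans (le_of_eq ?_) hcount)
    congr 1
    refine filter_congr fun R _ => ?_
    rw [hx _ (hsub R)]
    rfl
  calc ((K i + m).choose (K i) : ENNReal) * Q B
      = ∑ R ∈ powersetCard (K i) (univ : Finset (Fin (K i + m))),
          sampleMeasure P L (Ψ R ⁻¹' B) := by
        rw [sum_congr rfl fun R hR =>
          (hΨ_mp R (mem_powersetCard.1 hR).2).measure_preimage hBm.nullMeasurableSet]
        rw [sum_const, card_powersetCard, card_univ, Fintype.card_fin, nsmul_eq_mul]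
    _ = ∫⁻ ω, ∑ R ∈ powersetCard (K i) (univ : Finset (Fin (K i + m))),
          (Ψ R ⁻¹' B).indicator (1 : (∀ j, Fin (L j) → Δ) → ENNReal) ω ∂sampleMeasure P L := by
        have hm : ∀ R ∈ powersetCard (K i) (univ : Finset (Fin (K i + m))),
            MeasurableSet (Ψ R ⁻¹' B) := fun R hR =>
          (hΨ_mp R (mem_powersetCard.1 hR).2).measurable hBm
        rw [lintegral_finsetSum _ fun R hR => measurable_one.indicator (hm R hR)]
        exact sum_congr rfl fun R hR => (lintegral_indicator_one (hm R hR)).symm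
    _ ≤ ∫⁻ _, T ∂sampleMeasure P L := lintegral_mono_ae hae
    _ = T := by
        have : IsProbabilityMeasure (sampleMeasure P L) := by
          unfold sampleMeasure
          infer_instance
        rw [lintegral_const, measure_univ, mul_one]

/-- The sampling theorem for programs that are convex and invariant under `S` for every value of
the uncertainty. -/
theorem sampleMeasure_violationProb_le (P : Measure Δ) [IsProbabilityMeasure P]
    (M : MultiStageProgram d N Δ) (h : M.TieBreakRule) (hXne : M.X.Nonempty)
    (hXc : IsCompact M.X) (hX : Convex ℝ M.X) (hfm : ∀ i x, Measurable (M.f i x))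
    (hf : ∀ i δ, ConvexOn ℝ Set.univ fun x => M.f i x δ)
    (h_feasible : ∀ K : Fin N → ℕ, ∀ᵐ ω ∂sampleMeasure P K, (M.feasibleSet ω).Nonempty)
    (i : Fin N) (S : Submodule ℝ (EuclideanSpace ℝ (Fin d)))
    (hS : ∀ δ x, ∀ ξ ∈ S, M.f i (x + ξ) δ = M.f i x δ) (K : Fin N → ℕ) {ε : ℝ}
    (hε : ε ∈ Set.Ioo (0 : ℝ) 1) :
    (sampleMeasure P K) {ω | ε < M.violationProb P i ω} ≤
      ENNReal.ofReal (∑ j ∈ range (d - finrank ℝ S),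
        ((K i).choose j : ℝ) * ε ^ j * (1 - ε) ^ (K i - j)) := by
  classical
  obtain ⟨x, hxm, hx⟩ := M.exists_measurable_solution h hXne hXc hX hfm hf K
  set k := d - finrank ℝ S
  set n := K i
  set A : (∀ j, Fin (K j) → Δ) → Set Δ := fun y => {δ | 0 < M.f i (x y) δ} with hA
  have hAm : ∀ y, MeasurableSet (A y) := fun y => measurableSet_lt measurable_const (hfm i (x y))
  have hQ : IsProbabilityMeasure (sampleMeasure P K) := by
    unfold sampleMeasure
    infer_instance
  set g : ℕ → (∀ j, Fin (K j) → Δ) → ENNReal := fun m y =>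
    (Measure.pi fun _ : Fin m => P) {z | ⌈ε * m⌉₊ ≤ #{l | z l ∈ A y}} with hg
  have hBm : ∀ m : ℕ, MeasurableSet {p : (∀ j, Fin (K j) → Δ) × (Fin m → Δ) |
      ⌈ε * m⌉₊ ≤ #{l | 0 < M.f i (x p.1) (p.2 l)}} := by
    intro m
    have : Measurable fun p : (∀ j, Fin (K j) → Δ) × (Fin m → Δ) =>
        #{l | 0 < M.f i (x p.1) (p.2 l)} := by
      simp only [card_filter]
      refine Finset.measurable_sum _ fun l _ => Measurable.ite ?_ measurable_const measurable_const
      exact measurableSet_lt measurable_const (M.measurable_constraint_comp hfm hf i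
        (hxm.comp measurable_fst) ((measurable_pi_apply l).comp measurable_snd))
    exact measurableSet_le measurable_const this
  have hgm : ∀ m, Measurable (g m) := fun m => measurable_measure_prodMk_left (hBm m)
  have hgint : ∀ m, ∫⁻ y, g m y ∂sampleMeasure P K =
      ((sampleMeasure P K).prod (Measure.pi fun _ : Fin m => P))
        {p | ⌈ε * m⌉₊ ≤ #{l | 0 < M.f i (x p.1) (p.2 l)}} := fun m =>
    (Measure.prod_apply (hBm m)).symm
  -- The length s + k - 1 of the initial segment in the counting bound; it is asymptotic to εm.
  set a : ℕ → ℕ := fun m => ⌈ε * m⌉₊ + k - 1 with ha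
  set b : ℕ → ℕ := fun m => n + m - a m with hb
  have halim : Tendsto (fun m : ℕ => (a m : ℝ) / m) atTop (𝓝 ε) := by
    have h1 : Tendsto (fun m : ℕ => ε - (1 : ℝ) / m) atTop (𝓝 (ε - 0)) :=
      tendsto_const_nhds.sub (tendsto_const_div_atTop_nhds_zero_nat 1)
    have h2 : Tendsto (fun m : ℕ => ε + ((k : ℝ) + 1) / m) atTop (𝓝 (ε + 0)) :=
      tendsto_const_nhds.add (tendsto_const_div_atTop_nhds_zero_nat _)
    rw [sub_zero] at h1
    rw [add_zero] at h2
    refine tendsto_of_tendsto_of_tendsto_of_le_of_le' h1 h2 ?_ ?_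
    · filter_upwards [eventually_gt_atTop 0] with m hm
      have hm' : (0 : ℝ) < m := by exact_mod_cast hm
      rw [le_div_iff₀ hm', sub_mul, div_mul_cancel₀ _ hm'.ne']
      have h3 := Nat.le_ceil (ε * m)
      have h4 : ⌈ε * m⌉₊ ≤ a m + 1 := by
        simp only [ha]
        omega
      have h5 : (⌈ε * m⌉₊ : ℝ) ≤ a m + 1 := by exact_mod_cast h4
      linarith
    · filter_upwards [eventually_gt_atTop 0] with m hm
      have hm' : (0 : ℝ) < m := by exact_mod_cast hm
      rw [div_le_iff₀ hm', add_mul, div_mul_cancel₀ _ hm'.ne']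
      have h3 := (Nat.ceil_lt_add_one (mul_pos hε.1 hm').le).le
      have h4 : a m ≤ ⌈ε * m⌉₊ + k := by
        simp only [ha]
        omega
      have h5 : (a m : ℝ) ≤ ⌈ε * m⌉₊ + k := by exact_mod_cast h4
      linarith
  have hale : ∀ᶠ m in atTop, a m ≤ n + m := by
    filter_upwards [halim.eventually_lt_const hε.2, eventually_gt_atTop 0] with m hm hm0
    have hm' : (0 : ℝ) < m := by exact_mod_cast hm0
    rw [div_lt_one hm'] at hm
    have : a m < m := by exact_mod_cast hm
    omega
  have hblim : Tendsto (fun m : ℕ => (b m : ℝ) / m) atTop (𝓝 (1 - ε)) := by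
    have h1 : Tendsto (fun m : ℕ => (n : ℝ) / m + (1 - (a m : ℝ) / m)) atTop
        (𝓝 (0 + (1 - ε))) :=
      (tendsto_const_div_atTop_nhds_zero_nat _).add (tendsto_const_nhds.sub halim)
    rw [zero_add] at h1
    refine h1.congr' ?_
    filter_upwards [hale, eventually_gt_atTop 0] with m hm hm0
    have hm' : (m : ℝ) ≠ 0 := by positivity
    simp only [hb]
    rw [Nat.cast_sub hm]
    push_cast
    field_simp
    ring
  have hlim := tendsto_hypergeometric n k halim hblim
  set r : ℕ → ℝ := fun m => (∑ j ∈ range k, if j ≤ n then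
    ((a m).choose j : ℝ) * (b m).choose (n - j) else 0) / ((n + m).choose n : ℝ) with hr
  have hbound : ∀ᶠ m in atTop, ∫⁻ y, g m y ∂sampleMeasure P K ≤ ENNReal.ofReal (r m) := by
    filter_upwards [hale, eventually_gt_atTop 0] with m hm hm0
    have hm' : (0 : ℝ) < m := by exact_mod_cast hm0
    have h1 := M.prod_measure_violated_le P h hXc hX hfm hf h_feasible i S hS hxm hx m ⌈ε * m⌉₊
      (Nat.ceil_pos.2 (mul_pos hε.1 hm'))
    have h2 := card_filter_initial_le (M := n + m) n k (a m) hm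
    have h3 := h1.trans (Nat.cast_le.2 h2)
    rw [← hgint] at h3
    have hc : 0 < (n + m).choose n := Nat.choose_pos (Nat.le_add_right n m)
    have hc' : (0 : ℝ) < (n + m).choose n := by exact_mod_cast hc
    rw [hr]
    simp only
    rw [ENNReal.ofReal_div_of_pos hc', ENNReal.ofReal_natCast,
      ENNReal.le_div_iff_mul_le (Or.inl (by exact_mod_cast hc.ne'))
        (Or.inl (ENNReal.natCast_ne_top _)), mul_comm]
    refine h3.trans (le_of_eq ?_)
    rw [← ENNReal.ofReal_natCast]
    push_cast
    rfl
  have hliminf : liminf (fun m => ∫⁻ y, g m y ∂sampleMeasure P K) atTop ≤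
      ENNReal.ofReal (∑ j ∈ range k, (n.choose j : ℝ) * ε ^ j * (1 - ε) ^ (n - j)) := by
    rw [← (ENNReal.tendsto_ofReal hlim).liminf_eq]
    exact liminf_le_liminf hbound
  -- Fatou's lemma: where the violation probability exceeds ε, the law of large numbers gives g m →
  -- 1. The measurable set D avoids any claim on measurability of the event itself.
  refine le_trans ?_ ((lintegral_liminf_le hgm).trans hliminf)
  set D : Set (∀ j, Fin (K j) → Δ) := {y | 1 ≤ liminf (fun m => g m y) atTop}
  have hDm : MeasurableSet D := measurableSet_le measurable_const (Measurable.liminf hgm)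
  calc (sampleMeasure P K) {ω | ε < M.violationProb P i ω}
      ≤ (sampleMeasure P K) D := by
        refine measure_mono_ae ?_
        filter_upwards [h_feasible K] with y hy hyV
        have hyV : ε < P.real {δ | 0 < M.f i (M.solution y) δ} := hyV
        rw [hx y hy] at hyV
        exact (tendsto_measure_card_ge P (hAm y) hyV).liminf_eq.ge
    _ = ∫⁻ y, D.indicator 1 y ∂sampleMeasure P K := (lintegral_indicator_one hDm).symm
    _ ≤ ∫⁻ y, liminf (fun m => g m y) atTop ∂sampleMeasure P K := by
        refine lintegral_mono fun y => ?_
        by_cases hy : y ∈ D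
        · rw [Set.indicator_of_mem hy]
          exact hy
        · rw [Set.indicator_of_notMem hy]
          exact zero_le

end MultiStageProgram

/-! ### Removing a null set of uncertainties -/

namespace MultiStageProgram

variable {d N : ℕ} {Δ : Type*}

theorem ae_forall_sample_mem [MeasurableSpace Δ] (P : Measure Δ) [IsProbabilityMeasure P] {D : Set Δ}
    (hD : ∀ᵐ δ ∂P, δ ∈ D) (K : Fin N → ℕ) :
    ∀ᵐ ω ∂sampleMeasure P K, ∀ j κ, ω j κ ∈ D := by
  rw [ae_all_iff]
  intro j
  rw [ae_all_iff]
  intro κ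
  have h1 := measurePreserving_eval (fun j => Measure.pi fun _ : Fin (K j) => P) j
  have h2 := measurePreserving_eval (fun _ : Fin (K j) => P) κ
  exact (h2.comp h1).quasiMeasurePreserving.ae hD

/-- The program whose constraints are dropped for the uncertainties outside `D`. -/
noncomputable def restrict (M : MultiStageProgram d N Δ) (D : Set Δ) :
    MultiStageProgram d N Δ where
  c := M.c
  X := M.X
  f j x := D.indicator (M.f j x)
  p := M.p
  tieBreak := M.tieBreak

theorem feasibleSet_restrict (M : MultiStageProgram d N Δ) {D : Set Δ} {K : Fin N → ℕ}
    {ω : ∀ i, Fin (K i) → Δ} (hω : ∀ j κ, ω j κ ∈ D) :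
    (M.restrict D).feasibleSet ω = M.feasibleSet ω := by
  ext x
  refine and_congr_right fun _ => forall_congr' fun j => forall_congr' fun κ => ?_
  change D.indicator (M.f j x) (ω j κ) ≤ 0 ↔ _
  rw [Set.indicator_of_mem (hω j κ)]

theorem violationProb_restrict [MeasurableSpace Δ] (M : MultiStageProgram d N Δ) (P : Measure Δ) {D : Set Δ}
    (hD : ∀ᵐ δ ∂P, δ ∈ D) (i : Fin N) {K : Fin N → ℕ} {ω : ∀ i, Fin (K i) → Δ}
    (hω : ∀ j κ, ω j κ ∈ D) :
    (M.restrict D).violationProb P i ω = M.violationProb P i ω := by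
  have hsol : (M.restrict D).solution ω = M.solution ω := by
    unfold solution
    rw [feasibleSet_restrict M hω]
    rfl
  unfold violationProb
  rw [hsol]
  refine measureReal_congr ?_
  filter_upwards [hD] with δ hδ
  change (0 < D.indicator (M.f i (M.solution ω)) δ) = (0 < M.f i (M.solution ω) δ)
  rw [Set.indicator_of_mem hδ]

end MultiStageProgram

theorem theorem5p1 {d N : ℕ} {Δ : Type*} [MeasurableSpace Δ] (P : Measure Δ)
    [IsProbabilityMeasure P] (M : MultiStageProgram d N Δ) (ε : Fin N → ℝ)
    (hε : ∀ i, ε i ∈ Set.Ioo (0 : ℝ) 1)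
    (hX_compact : IsCompact M.X) (hX_convex : Convex ℝ M.X)
    (hf_measurable : ∀ i x, Measurable (M.f i x))
    (hf_convex : ∀ i, ∀ᵐ δ ∂P, ConvexOn ℝ Set.univ fun x => M.f i x δ)
    (h_tie : M.TieBreakRule)
    (h_feasible : ∀ K : Fin N → ℕ,
      ∀ᵐ ω ∂MultiStageProgram.sampleMeasure P K, (M.feasibleSet ω).Nonempty)
    (K : Fin N → ℕ) (i : Fin N) :
    (MultiStageProgram.sampleMeasure P K).real {ω | ε i < M.violationProb P i ω} ≤
      binomialCDF ((M.supportRank P i : ℤ) - 1) (K i) (ε i) := by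
  classical
  have hQ : IsProbabilityMeasure (MultiStageProgram.sampleMeasure P K) := by
    unfold MultiStageProgram.sampleMeasure
    infer_instance
  have hXne : M.X.Nonempty := by
    obtain ⟨ω, x, hx⟩ := (h_feasible K).exists
    exact ⟨x, hx.1⟩
  set S := M.unconstrainedSubspace P i with hS
  have hSinv : ∀ᵐ δ ∂P, ∀ x ∈ M.X, (S : Set (EuclideanSpace ℝ (Fin d))) ⊆ M.levelSet i x δ :=
    (M.isGreatest_unconstrainedSubspace P i hXne (hf_convex i)).1
  -- Invariance is assumed at points of X only; for a convex function, constancy along lines through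
  -- one such point extends it to the whole space.
  have hgood : ∀ᵐ δ ∂P, (∀ j, ConvexOn ℝ Set.univ fun x => M.f j x δ) ∧
      ∀ x, ∀ ξ ∈ S, M.f i (x + ξ) δ = M.f i x δ := by
    filter_upwards [ae_all_iff.2 hf_convex, hSinv] with δ h1 h2
    refine ⟨h1, fun x ξ hξ => ?_⟩
    obtain ⟨x₀, hx₀⟩ := hXne
    exact MultiStageProgram.convex_invariant (h1 i) (x := x₀) (ξ := ξ)
      (fun s => h2 x₀ hx₀ (S.smul_mem s hξ)) x
  -- The exceptional set is enlarged to a measurable one so that the restricted constraint functions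
  -- remain measurable.
  obtain ⟨Z, hZ, hZm, hZ0⟩ := exists_measurable_superset_of_null (ae_iff.1 hgood)
  set D := Zᶜ with hD
  have hDm : MeasurableSet D := hZm.compl
  have hDae : ∀ᵐ δ ∂P, δ ∈ D := by
    rw [ae_iff]
    simpa [hD] using hZ0
  have hDgood : ∀ δ ∈ D, (∀ j, ConvexOn ℝ Set.univ fun x => M.f j x δ) ∧
      ∀ x, ∀ ξ ∈ S, M.f i (x + ξ) δ = M.f i x δ := by
    intro δ hδ
    by_contra hcon
    exact hδ (hZ hcon)
  have hrestrict : ∀ j x δ, (M.restrict D).f j x δ = D.indicator (M.f j x) δ := fun _ _ _ => rfl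
  have main := (M.restrict D).sampleMeasure_violationProb_le P h_tie hXne hX_compact hX_convex
    (fun j x => (hf_measurable j x).indicator hDm) (by
      intro j δ
      by_cases hδ : δ ∈ D
      · simp only [hrestrict, Set.indicator_of_mem hδ]
        exact (hDgood δ hδ).1 j
      · simp only [hrestrict, Set.indicator_of_notMem hδ]
        exact convexOn_const 0 convex_univ) (by
      intro L
      filter_upwards [h_feasible L, MultiStageProgram.ae_forall_sample_mem P hDae L] with ω h1 h2
      rwa [M.feasibleSet_restrict h2]) i S (by
      intro δ x ξ hξ
      by_cases hδ : δ ∈ D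
      · simp only [hrestrict, Set.indicator_of_mem hδ]
        exact (hDgood δ hδ).2 x ξ hξ
      · simp only [hrestrict, Set.indicator_of_notMem hδ]) K (hε i)
  have heq : (MultiStageProgram.sampleMeasure P K) {ω | ε i < M.violationProb P i ω} =
      (MultiStageProgram.sampleMeasure P K) {ω | ε i < (M.restrict D).violationProb P i ω} := by
    refine measure_congr ?_
    filter_upwards [MultiStageProgram.ae_forall_sample_mem P hDae K] with ω hω
    change (ε i < M.violationProb P i ω) = (ε i < (M.restrict D).violationProb P i ω)
    rw [M.violationProb_restrict P hDae i hω]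
  have hε0 := (hε i).1.le
  have hε1 := sub_nonneg.2 (hε i).2.le
  rw [Measure.real, heq]
  refine (ENNReal.toReal_le_of_le_ofReal (Finset.sum_nonneg fun j _ => by positivity) main).trans
    (le_of_eq ?_)
  rw [binomialCDF, sub_add_cancel, Int.toNat_natCast, MultiStageProgram.supportRank, hS]
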